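/- For a measurable real-valued function $f$ on a measurable set $\Omega\subset\mathbb R^n$ and $1\le p<\infty$, let $$\|f\|_{L^{p,\infty}(\Omega)}=\inf\bigl\{C>0:\ |\{x\in\Omega:|f(x)|>\alpha\}|\le C^p/\alpha^p\ \text{ for all }\alpha>0\bigr\},$$ and let $L^{p,\infty}(\Omega)$ be the set of those $f$ for which this is finite. Let $\mathrm{BMO}(\mathbb R^n)$ be the set of $f\in L^1_{\mathrm{loc}}(\mathbb R^n)$ with $$\|f\|_{\mathrm{BMO}}=\sup_Q \frac1{|Q|}\int_Q|f-f_Q|\,dx<\infty,\qquad f_Q=\frac1{|Q|}\int_Q f\,dx,$$ where the supremum is over all cubes $Q$ with sides parallel to the axes. Gradients are weak gradients, and $\dot H^1(\mathbb R^2)$ denotes the set of $f\in L^1_{\mathrm{loc}}(\mathbb R^2)$ with $\nabla f\in L^2(\mathbb R^2)$. (i) Let $n\ge1$ and $1\le q<p<\infty$. There is a constant $c=c(n,p,q)$ such that every $f\in L^{q,\infty}(\mathbb R^n)\cap\mathrm{BMO}(\mathbb R^n)$ lies in $L^p(\mathbb R^n)$ and $$\|f\|_{L^p}\le c\,\|f\|_{L^{q,\infty}}^{q/p}\,\|f\|_{\mathrm{BMO}}^{1-q/p}.$$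 (ii) $\dot H^1(\mathbb R^2)\subset\mathrm{BMO}(\mathbb R^2)$, with $\|f\|_{\mathrm{BMO}}\le c\,\|\nabla f\|_{L^2}$ for an absolute constant $c$. (iii) (Weak Ladyzhenskaya inequality.) There is an absolute constant $c$ such that the estimate $$\|f\|_{L^4(\Omega)}\le c\,\|f\|_{L^{2,\infty}(\Omega)}^{1/2}\,\|\nabla f\|_{L^2(\Omega)}^{1/2}$$ (in particular $f\in L^4(\Omega)$) holds in each of the following cases: - $\Omega=\mathbb R^2$ and $f\in L^{2,\infty}(\mathbb R^2)\cap\dot H^1(\mathbb R^2)$; - $\Omega\subset\mathbb R^2$ is a bounded open set (for instance a bounded Lipschitz domain) and $f\in H^1_0(\Omega)$, the closure of $C_c^\infty(\Omega)$ in $H^1(\Omega)$; - $\Omega=[0,1]^2$ with periodic boundary conditions, and $f\in H^1$ is periodic with zero mean, $\int_{[0,1]^2}f\,dx=0$. -/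

import Mathlib

open MeasureTheory Filter Topology
open scoped ENNReal NNReal ContDiff

/-- The distribution function `d_f(α) = μ {x : |f x| > α}`. For functions on a measurable set `Ω`,
take `μ` to be Lebesgue measure restricted to `Ω`. -/
noncomputable def distribFun {X : Type*} [MeasurableSpace X] (f : X → ℝ) (μ : Measure X)
    (α : ℝ) : ℝ≥0∞ :=
  μ {x | α < |f x|}

/-- The weak `L^p` quasi-norm, the infimum of all `C > 0` such that `d_f(α) ≤ C^p / α^p` for all
`α > 0`; it is `∞` when there is no such `C`. -/
noncomputable def weakLpNorm {X : Type*} [MeasurableSpace X] (f : X → ℝ) (p : ℝ)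
    (μ : Measure X) : ℝ≥0∞ :=
  ⨅ (C : ℝ) (_ : 0 < C ∧ ∀ α : ℝ, 0 < α → distribFun f μ α ≤ ENNReal.ofReal (C ^ p / α ^ p)),
    ENNReal.ofReal C

/-- Membership in the weak Lebesgue space `L^{p,∞}(μ)`. -/
def MemWeakLp {X : Type*} [MeasurableSpace X] (f : X → ℝ) (p : ℝ) (μ : Measure X) : Prop :=
  AEStronglyMeasurable f μ ∧ weakLpNorm f p μ < ⊤

/-- The closed cube with lowest corner `a` and side length `s`, with sides parallel to the axes. -/
def axisCube {n : ℕ} (a : EuclideanSpace ℝ (Fin n)) (s : ℝ) : Set (EuclideanSpace ℝ (Fin n)) :=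
  {x | ∀ i, x i ∈ Set.Icc (a i) (a i + s)}

/-- The `BMO` seminorm, the supremum over all cubes `Q` of the mean oscillation
`⨍_Q |f - f_Q|`, where `f_Q = ⨍_Q f`. -/
noncomputable def bmoSeminorm {n : ℕ} (f : EuclideanSpace ℝ (Fin n) → ℝ) : ℝ≥0∞ :=
  ⨆ (a : EuclideanSpace ℝ (Fin n)) (s : ℝ) (_ : 0 < s),
    ⨍⁻ x in axisCube a s, ‖f x - ⨍ y in axisCube a s, f y‖ₑ ∂volume

/-- Membership in `BMO(ℝⁿ)`. -/
def MemBMO {n : ℕ} (f : EuclideanSpace ℝ (Fin n) → ℝ) : Prop :=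
  LocallyIntegrable f volume ∧ bmoSeminorm f < ⊤

/-- Test functions, the elements of `C_c^∞(Ω)`. -/
def IsTestFunction {n : ℕ} (Ω : Set (EuclideanSpace ℝ (Fin n)))
    (φ : EuclideanSpace ℝ (Fin n) → ℝ) : Prop :=
  ContDiff ℝ ∞ φ ∧ HasCompactSupport φ ∧ tsupport φ ⊆ Ω

/-- `g` is the weak gradient of `f` in the open set `Ω`. -/
def IsWeakGradient {n : ℕ} (Ω : Set (EuclideanSpace ℝ (Fin n)))
    (f : EuclideanSpace ℝ (Fin n) → ℝ)
    (g : EuclideanSpace ℝ (Fin n) → EuclideanSpace ℝ (Fin n)) : Prop :=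
  LocallyIntegrableOn f Ω volume ∧ LocallyIntegrableOn g Ω volume ∧
    ∀ φ : EuclideanSpace ℝ (Fin n) → ℝ, IsTestFunction Ω φ → ∀ i : Fin n,
      ∫ x in Ω, f x * (gradient φ x) i = -∫ x in Ω, (g x) i * φ x

/-- `f` belongs to the homogeneous space `Ḣ¹(ℝⁿ)` and `∇f = g`. -/
def MemHomH1 {n : ℕ} (f : EuclideanSpace ℝ (Fin n) → ℝ)
    (g : EuclideanSpace ℝ (Fin n) → EuclideanSpace ℝ (Fin n)) : Prop :=
  IsWeakGradient Set.univ f g ∧ MemLp g 2 volume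

/-- `f` belongs to `H¹(Ω)` and `∇f = g`. -/
def MemH1 {n : ℕ} (Ω : Set (EuclideanSpace ℝ (Fin n))) (f : EuclideanSpace ℝ (Fin n) → ℝ)
    (g : EuclideanSpace ℝ (Fin n) → EuclideanSpace ℝ (Fin n)) : Prop :=
  IsWeakGradient Ω f g ∧ MemLp f 2 (volume.restrict Ω) ∧ MemLp g 2 (volume.restrict Ω)

/-- `f` belongs to `H¹₀(Ω)`, the closure of `C_c^∞(Ω)` in `H¹(Ω)`, and `∇f = g`. -/
def MemH10 {n : ℕ} (Ω : Set (EuclideanSpace ℝ (Fin n))) (f : EuclideanSpace ℝ (Fin n) → ℝ)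
    (g : EuclideanSpace ℝ (Fin n) → EuclideanSpace ℝ (Fin n)) : Prop :=
  MemH1 Ω f g ∧ ∃ φ : ℕ → EuclideanSpace ℝ (Fin n) → ℝ, (∀ k, IsTestFunction Ω (φ k)) ∧
    Tendsto (fun k => eLpNorm (fun x => φ k x - f x) 2 (volume.restrict Ω)) atTop (𝓝 0) ∧
    Tendsto (fun k => eLpNorm (fun x => gradient (φ k) x - g x) 2 (volume.restrict Ω))
      atTop (𝓝 0)

/-- `f` belongs to `H¹` of the unit cube `[0,1]ⁿ` with periodic boundary conditions and `∇f = g`: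
`f` is a `ℤⁿ`-periodic function on `ℝⁿ` with weak gradient `g` on `ℝⁿ`, and `f` and `g` are square
integrable on the unit cube. -/
def MemH1Per {n : ℕ} (f : EuclideanSpace ℝ (Fin n) → ℝ)
    (g : EuclideanSpace ℝ (Fin n) → EuclideanSpace ℝ (Fin n)) : Prop :=
  (∀ i : Fin n, (fun x => f (x + EuclideanSpace.single i 1)) =ᵐ[volume] f) ∧
    IsWeakGradient Set.univ f g ∧
    MemLp f 2 (volume.restrict (axisCube 0 1)) ∧ MemLp g 2 (volume.restrict (axisCube 0 1))

/-! ### John–Nirenberg inequality for nested partitions -/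

section NestedPartition

/-! At low heights the distribution function of `f` is controlled by the weak norm, at large heights
by the exponential decay of John and Nirenberg. In the layer-cake integral of `t^(p-1) |{|f| > t}|`
the first bound gives convergence at 0, because `q < p`, and the second at infinity.

The decay is proved for refining partitions with mean oscillation at most 1 on cells, where a cell
has at most `D` times the measure of its child. Stop at the maximal cells whose average exceeds `l`
in absolute value. The parent did not stop, so the average is at most `l + D`; inside such a cell
`P`, stopping again at `l + (D + 2)` forces a change of average by more than 2, and oscillation at
most `μ P` leaves at most half of `P` for it. Thus each step `D + 2` halves the level set of the
maximal function (`two_mul_measure_maximal_le`). The iteration starts not from the measure of a cube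
but from `{|f| > 2}`: a cell with average above 4 has `|f| > 2` on at least half of it
(`measure_maximal_le_two_mul`). The bounds are therefore independent of the size of the cube.

Dyadic cells give the estimate on a cube once the average over the whole cube is small
(`lintegral_rpow_axisCube_le`). On `ℝⁿ` the weak bound makes averages over large cubes small, and
cubes exhaust the space; on the unit square the mean is zero.

The embedding of `Ḣ¹(ℝ²)` in `BMO` is the Poincaré inequality, scale invariant in dimension two:
differences of `f` are integrals of the gradient along segments, and Cauchy–Schwarz turns its `L¹`
norm into an `L²` norm. Functions in `H¹₀(Ω)` are extended by zero. -/

theorem eq_of_refining {X ι : Type*} {c : ℕ → X → ι}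
    (href : ∀ k x y, c (k + 1) x = c (k + 1) y → c k x = c k y)
    {i k : ℕ} (hik : i ≤ k) {x y : X} (h : c k x = c k y) : c i x = c i y := by
  induction hik with
  | refl => exact h
  | step _ ih => exact ih (href _ _ _ h)

variable {X ι : Type*} [MeasurableSpace X] [Countable ι] {c : ℕ → X → ι}

theorem measurableSet_exists_cell (hc : ∀ k j, MeasurableSet (c k ⁻¹' {j})) (p : ℕ → ι → Prop) :
    MeasurableSet {x | ∃ k, p k (c k x)} := by
  have : {x | ∃ k, p k (c k x)} = ⋃ k, ⋃ j ∈ {j | p k j}, c k ⁻¹' {j} := by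
    ext x; simp
  rw [this]
  exact MeasurableSet.iUnion fun k => MeasurableSet.biUnion (Set.to_countable _) fun j _ => hc k j

/-- A comparison of measures on maximal cells with a given property extends to the union of all
cells with that property. -/
theorem measure_le_of_maximal_cells (hc : ∀ k j, MeasurableSet (c k ⁻¹' {j}))
    (href : ∀ k x y, c (k + 1) x = c (k + 1) y → c k x = c k y)
    {ν₁ ν₂ : Measure X} (p : ℕ → ι → Prop)
    (h : ∀ k x, p k (c k x) → (∀ i < k, ¬ p i (c i x)) →
      ν₁ (c k ⁻¹' {c k x}) ≤ ν₂ (c k ⁻¹' {c k x})) :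
    ν₁ {x | ∃ k, p k (c k x)} ≤ ν₂ {x | ∃ k, p k (c k x)} := by
  classical
  -- Index the maximal cells: those with the property and no ancestor with it. Nestedness makes them
  -- disjoint, they cover the union, and there are countably many.
  set S : Set (ℕ × ι) := {s | p s.1 s.2 ∧ ∃ x, c s.1 x = s.2 ∧ ∀ i < s.1, ¬ p i (c i x)} with hS
  have hE : {x | ∃ k, p k (c k x)} = ⋃ s ∈ S, c s.1 ⁻¹' {s.2} := by
    ext x
    simp only [Set.mem_ofPred_eq, Set.mem_iUnion, Set.mem_preimage, Set.mem_singleton_iff,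
      exists_prop]
    constructor
    · intro hx
      exact ⟨(Nat.find hx, c (Nat.find hx) x),
        ⟨Nat.find_spec hx, x, rfl, fun i hi => Nat.find_min hx hi⟩, rfl⟩
    · rintro ⟨⟨k, j⟩, ⟨hp, -⟩, hx⟩
      exact ⟨k, hx.symm ▸ hp⟩
  have hdisj : S.PairwiseDisjoint fun s => c s.1 ⁻¹' {s.2} := by
    rintro ⟨k, j⟩ ⟨hp, x, hx, hmin⟩ ⟨k', j'⟩ ⟨hp', x', hx', hmin'⟩ hne
    rw [Function.onFun, Set.disjoint_left]
    intro y hy hy'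
    simp only [Set.mem_preimage, Set.mem_singleton_iff] at hy hy' hx hx' hp hp' hmin hmin'
    rcases lt_trichotomy k k' with hlt | rfl | hlt
    · have : c k x' = c k y := eq_of_refining href hlt.le (hx'.trans hy'.symm)
      exact hmin' k hlt (by rw [this, hy]; exact hp)
    · exact hne (by rw [← hy, ← hy'])
    · have : c k' x = c k' y := eq_of_refining href hlt.le (hx.trans hy.symm)
      exact hmin k' hlt (by rw [this, hy']; exact hp')
  rw [hE, measure_biUnion S.to_countable hdisj fun s _ => hc _ _,
    measure_biUnion S.to_countable hdisj fun s _ => hc _ _]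
  refine ENNReal.tsum_le_tsum ?_
  rintro ⟨⟨k, j⟩, hp, x, hx, hmin⟩
  obtain rfl : c k x = j := hx
  exact h k x hp hmin

/-- A lower bound for the oscillation around a constant on a set of different average. -/
theorem mul_measure_le_lintegral_sub_of_average {μ : Measure X} [IsFiniteMeasure μ] {f : X → ℝ}
    (hf : Integrable f μ) (R : Set X) (a : ℝ) :
    ENNReal.ofReal |(⨍ y in R, f y ∂μ) - a| * μ R ≤ ∫⁻ y in R, ‖f y - a‖ₑ ∂μ := by
  by_cases h0 : μ R = 0
  · simp [h0]
  have hR : μ.real R ≠ 0 := by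
    simpa [Measure.real, ENNReal.toReal_eq_zero_iff] using h0
  have h1 : ∫ y in R, (f y - a) ∂μ = μ.real R * ((⨍ y in R, f y ∂μ) - a) := by
    rw [integral_sub hf.integrableOn (integrable_const a), setAverage_eq]
    simp
    field_simp
  calc ENNReal.ofReal |(⨍ y in R, f y ∂μ) - a| * μ R
      = ‖∫ y in R, (f y - a) ∂μ‖ₑ := by
        rw [h1, enorm_mul, mul_comm, Real.enorm_eq_ofReal_abs ((⨍ y in R, f y ∂μ) - a),
          Real.enorm_eq_ofReal measureReal_nonneg, ofReal_measureReal]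
    _ ≤ _ := enorm_integral_le_lintegral_enorm _

/-- If a function has large average and small oscillation on a cell, it is large on at least half
of that cell. -/
theorem measure_le_two_mul_of_average_large {μ : Measure X} [IsFiniteMeasure μ] {f : X → ℝ}
    (hf : Integrable f μ) {R : Set X} (hR : MeasurableSet R) {b l : ℝ} (hb : 0 < b)
    (hl : 4 * b ≤ l) (havg : l < |⨍ y in R, f y ∂μ|)
    (hosc : ∫⁻ y in R, ‖f y - ⨍ z in R, f z ∂μ‖ₑ ∂μ ≤ ENNReal.ofReal b * μ R) :
    μ R ≤ 2 * μ (R ∩ {x | l / 2 < |f x|}) := by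
  set a := ⨍ z in R, f z ∂μ with ha
  -- Where `|f| ≤ l / 2`, the distance from `f` to the average exceeds `l / 2 ≥ 2 * b`; Chebyshev at
  -- height `2 * b` gives this set at most half of `R`.
  have hsub : R ⊆ (R ∩ {x | l / 2 < |f x|}) ∪ (R ∩ {x | ENNReal.ofReal (2 * b) ≤ ‖f x - a‖ₑ}) := by
    intro x hx
    by_cases h : l / 2 < |f x|
    · exact Or.inl ⟨hx, h⟩
    · refine Or.inr ⟨hx, ?_⟩
      rw [Set.mem_ofPred_eq, Real.enorm_eq_ofReal_abs]
      apply ENNReal.ofReal_le_ofReal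
      have := abs_sub_abs_le_abs_sub a (f x)
      rw [abs_sub_comm] at this
      linarith
  have hcheb : ENNReal.ofReal (2 * b) * μ (R ∩ {x | ENNReal.ofReal (2 * b) ≤ ‖f x - a‖ₑ}) ≤
      ENNReal.ofReal b * μ R := by
    refine le_trans ?_ hosc
    have := mul_meas_ge_le_lintegral₀ (μ := μ.restrict R) (f := fun y => ‖f y - a‖ₑ)
      ((hf.aestronglyMeasurable.restrict.sub aestronglyMeasurable_const).enorm)
      (ENNReal.ofReal (2 * b))
    rwa [Measure.restrict_apply' hR, Set.inter_comm] at this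
  have hcheb' : 2 * μ (R ∩ {x | ENNReal.ofReal (2 * b) ≤ ‖f x - a‖ₑ}) ≤ μ R := by
    generalize μ (R ∩ {x | ENNReal.ofReal (2 * b) ≤ ‖f x - a‖ₑ}) = t at hcheb ⊢
    rw [mul_comm 2 b, ENNReal.ofReal_mul hb.le, mul_assoc] at hcheb
    simpa using (ENNReal.mul_le_mul_iff_right (by simpa using hb) ENNReal.ofReal_ne_top).1 hcheb
  have h2 := (measure_mono (μ := μ) hsub).trans (measure_union_le _ _)
  have hfin : μ R ≠ ⊤ := measure_ne_top _ _
  have h3 : μ R + μ R ≤ 2 * μ (R ∩ {x | l / 2 < |f x|}) + μ R := by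
    calc μ R + μ R = 2 * μ R := (two_mul _).symm
      _ ≤ 2 * (μ (R ∩ {x | l / 2 < |f x|}) +
          μ (R ∩ {x | ENNReal.ofReal (2 * b) ≤ ‖f x - a‖ₑ})) := by gcongr
      _ ≤ _ := by rw [mul_add]; gcongr
  exact (ENNReal.add_le_add_iff_right hfin).1 h3

variable {μ : Measure X} [IsFiniteMeasure μ] {f : X → ℝ}

/-- Starting point of the iteration: on each maximal cell `f` exceeds `l / 2` on at least half, and
these cells are disjoint. -/
theorem measure_maximal_le_two_mul (hc : ∀ k j, MeasurableSet (c k ⁻¹' {j}))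
    (href : ∀ k x y, c (k + 1) x = c (k + 1) y → c k x = c k y) (hf : Integrable f μ)
    (hosc : ∀ k j, ∫⁻ y in c k ⁻¹' {j}, ‖f y - ⨍ z in c k ⁻¹' {j}, f z ∂μ‖ₑ ∂μ ≤
      μ (c k ⁻¹' {j})) {l : ℝ} (hl : 4 ≤ l) :
    μ {x | ∃ k, l < |⨍ z in c k ⁻¹' {c k x}, f z ∂μ|} ≤ 2 * μ {x | l / 2 < |f x|} := by
  have key := measure_le_of_maximal_cells hc href (ν₁ := μ)
    -- The level set of `f` need not be measurable, so the comparison measure lives on a measurable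
    -- hull of the same measure.
    (ν₂ := (2 : ℝ≥0∞) • (μ.restrict (toMeasurable μ {x | l / 2 < |f x|})))
    (fun k j => l < |⨍ z in c k ⁻¹' {j}, f z ∂μ|) (by
      intro k x hp _
      refine (measure_le_two_mul_of_average_large hf (hc k _) (b := 1) one_pos (by linarith) hp
        (by simpa using hosc k _)).trans ?_
      rw [Measure.smul_apply, smul_eq_mul, Measure.restrict_apply (hc _ _)]
      gcongr
      exact subset_toMeasurable _ _)
  refine key.trans ?_
  rw [Measure.smul_apply, smul_eq_mul]
  gcongr 2 * ?_
  rw [Measure.restrict_apply' (measurableSet_toMeasurable _ _)]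
  exact (measure_mono Set.inter_subset_right).trans (measure_toMeasurable _).le

/-- The Calderón–Zygmund stopping step, performed separately inside each maximal cell of level `l`.
-/
theorem two_mul_measure_maximal_le (hc : ∀ k j, MeasurableSet (c k ⁻¹' {j}))
    (href : ∀ k x y, c (k + 1) x = c (k + 1) y → c k x = c k y) (hf : Integrable f μ)
    (hosc : ∀ k j, ∫⁻ y in c k ⁻¹' {j}, ‖f y - ⨍ z in c k ⁻¹' {j}, f z ∂μ‖ₑ ∂μ ≤
      μ (c k ⁻¹' {j})) {D l : ℝ} (hD : 0 ≤ D)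
    (hdoubl : ∀ k x, μ (c k ⁻¹' {c k x}) ≤ ENNReal.ofReal D * μ (c (k + 1) ⁻¹' {c (k + 1) x}))
    (h0 : ∀ j, |⨍ z in c 0 ⁻¹' {j}, f z ∂μ| ≤ l) :
    2 * μ {x | ∃ k, l + (D + 2) < |⨍ z in c k ⁻¹' {c k x}, f z ∂μ|} ≤
      μ {x | ∃ k, l < |⨍ z in c k ⁻¹' {c k x}, f z ∂μ|} := by
  set A : ℕ → ι → ℝ := fun k j => ⨍ z in c k ⁻¹' {j}, f z ∂μ with hA
  set E' := {x | ∃ k, l + (D + 2) < |A k (c k x)|} with hE'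
  set E := {x | ∃ k, l < |A k (c k x)|} with hE
  have hE'E : E' ⊆ E := fun x ⟨k, hk⟩ => ⟨k, by linarith⟩
  have hE'm : MeasurableSet E' := measurableSet_exists_cell hc fun k j => l + (D + 2) < |A k j|
  have key := measure_le_of_maximal_cells hc href (ν₁ := (2 : ℝ≥0∞) • (μ.restrict E')) (ν₂ := μ)
    (fun k j => l < |A k j|) ?_
  · refine le_trans ?_ key
    rw [Measure.smul_apply, smul_eq_mul]
    gcongr 2 * ?_
    rw [Measure.restrict_apply' hE'm]
    exact measure_mono fun x hx => ⟨hE'E hx, hx⟩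
  intro k x hp hmin
  rw [Measure.smul_apply, smul_eq_mul, Measure.restrict_apply (hc _ _)]
  set P := c k ⁻¹' {c k x} with hP
  by_cases hP0 : μ P = 0
  · rw [measure_mono_null Set.inter_subset_left hP0]; simp
  -- the average over a maximal cell is not much larger than `l`
  have hjump : |A k (c k x)| ≤ l + D := by
    rcases k with _ | k
    · exact absurd (h0 _) (not_le.2 hp)
    have h1 : |A k (c k x)| ≤ l := not_lt.1 (hmin k (Nat.lt_succ_self k))
    -- The parent has oscillation at most its own measure, hence at most `D * μ P`, so passing to
    -- the child moves the average by at most `D`.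
    have hPs : P ⊆ c k ⁻¹' {c k x} := fun y hy => href k y x hy
    have h2 := (mul_measure_le_lintegral_sub_of_average hf P (A k (c k x))).trans
      ((lintegral_mono_set hPs).trans ((hosc k _).trans (hdoubl k x)))
    have h3 := (ENNReal.mul_le_mul_iff_left hP0 (measure_ne_top _ _)).1 h2
    have h4 := (ENNReal.ofReal_le_ofReal_iff hD).1 h3
    have h5 := abs_sub_abs_le_abs_sub (A (k + 1) (c (k + 1) x)) (A k (c k x))
    have h6 : |A (k + 1) (c (k + 1) x) - A k (c k x)| ≤ D := h4
    linarith
  set p' : ℕ → ι → Prop := fun i j => c i ⁻¹' {j} ⊆ P ∧ l + (D + 2) < |A i j| with hp'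
  -- A cell through a point of `P` with average above the higher level cannot be coarser than `P`,
  -- since those averages are at most `l`; so it lies in `P`.
  have hsub : P ∩ E' ⊆ {y | ∃ i, p' i (c i y)} ∩ P := by
    rintro y ⟨hyP, i, hi⟩
    refine ⟨⟨i, ?_, hi⟩, hyP⟩
    have hy : c k y = c k x := hyP
    rcases lt_or_ge i k with hik | hik
    · have h1 : c i y = c i x := eq_of_refining href hik.le hy
      have h2 := hmin i hik
      rw [h1] at hi
      exact absurd (by linarith) h2
    · intro z hz
      exact (eq_of_refining href hik (show c i z = c i y from hz)).trans hy
  set F : Set X := {y | ∃ i, p' i (c i y)}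
  -- On each new cell the average differs from that of `P` by at least `(D + 2) - D = 2`, so twice
  -- its measure is at most the integral of the oscillation density over it. Summing over disjoint
  -- cells gives at most `μ P`.
  have hF := measure_le_of_maximal_cells hc href (ν₁ := (2 : ℝ≥0∞) • μ)
    (ν₂ := (μ.restrict P).withDensity fun y => ‖f y - A k (c k x)‖ₑ) p' (by
      intro i y hy _
      rw [Measure.smul_apply, smul_eq_mul, withDensity_apply _ (hc _ _),
        Measure.restrict_restrict (hc _ _), Set.inter_eq_left.2 hy.1]
      refine le_trans ?_ (mul_measure_le_lintegral_sub_of_average hf _ _)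
      gcongr
      rw [show (2 : ℝ≥0∞) = ENNReal.ofReal 2 by simp]
      apply ENNReal.ofReal_le_ofReal
      have h1 := abs_sub_abs_le_abs_sub (A i (c i y)) (A k (c k x))
      have h2 := hy.2
      change 2 ≤ |A i (c i y) - A k (c k x)|
      linarith)
  calc 2 * μ (P ∩ E') ≤ 2 * μ F := by gcongr; exact hsub.trans Set.inter_subset_left
    _ ≤ ((μ.restrict P).withDensity fun y => ‖f y - A k (c k x)‖ₑ) Set.univ :=
      hF.trans (measure_mono (Set.subset_univ _))
    _ = ∫⁻ y in P, ‖f y - A k (c k x)‖ₑ ∂μ := by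
      rw [withDensity_apply _ MeasurableSet.univ, Measure.restrict_univ]
    _ ≤ μ P := hosc k _

/-- Exponential decay of the distribution function of a function of bounded mean oscillation with
respect to a sequence of nested partitions. -/
theorem distribFun_le_of_bounded_oscillation (hc : ∀ k j, MeasurableSet (c k ⁻¹' {j}))
    (href : ∀ k x y, c (k + 1) x = c (k + 1) y → c k x = c k y) (hf : Integrable f μ)
    (hosc : ∀ k j, ∫⁻ y in c k ⁻¹' {j}, ‖f y - ⨍ z in c k ⁻¹' {j}, f z ∂μ‖ₑ ∂μ ≤
      μ (c k ⁻¹' {j})) {D : ℝ} (hD : 0 ≤ D)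
    (hdoubl : ∀ k x, μ (c k ⁻¹' {c k x}) ≤ ENNReal.ofReal D * μ (c (k + 1) ⁻¹' {c (k + 1) x}))
    (h0 : ∀ j, |⨍ z in c 0 ⁻¹' {j}, f z ∂μ| ≤ 4)
    (hlim : ∀ᵐ x ∂μ, Tendsto (fun k => ⨍ z in c k ⁻¹' {c k x}, f z ∂μ) atTop (𝓝 (f x))) (m : ℕ) :
    2 ^ m * distribFun f μ (4 + m * (D + 2)) ≤ 2 * distribFun f μ 2 := by
  have h1 : ∀ m : ℕ, 2 ^ m * μ {x | ∃ k, 4 + m * (D + 2) < |⨍ z in c k ⁻¹' {c k x}, f z ∂μ|} ≤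
      2 * μ {x | 2 < |f x|} := by
    intro m
    induction m with
    | zero =>
      have := measure_maximal_le_two_mul hc href hf hosc (l := 4) le_rfl
      norm_num at this ⊢
      exact this
    | succ m ih =>
      refine le_trans ?_ ih
      rw [pow_succ, mul_assoc]
      gcongr
      have := two_mul_measure_maximal_le hc href hf hosc hD hdoubl (l := 4 + m * (D + 2))
        fun j => (h0 j).trans (le_add_of_nonneg_right (by positivity))
      have he : (4 : ℝ) + (m + 1 : ℕ) * (D + 2) = 4 + m * (D + 2) + (D + 2) := by push_cast; ring
      rwa [he]
  refine le_trans ?_ (h1 m)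
  unfold distribFun
  gcongr 2 ^ m * ?_
  -- Averages converge to `f` almost everywhere, so wherever `|f|` exceeds the level some average
  -- already does.
  refine measure_mono_ae ?_
  filter_upwards [hlim] with x hx hlt
  exact ((hx.abs.eventually (lt_mem_nhds hlt)).exists)

end NestedPartition

/-! ### From decay of the distribution function to integrability -/

theorem distribFun_anti {X : Type*} [MeasurableSpace X] (f : X → ℝ) (μ : Measure X) :
    Antitone (distribFun f μ) :=
  fun _ _ h => measure_mono fun _ hx => lt_of_le_of_lt h hx

/-- Exponential decay beats every power; the real exponent is first rounded up to a natural one, the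
base being at least 1. -/
theorem exists_bound_rpow_mul_half_pow (r T : ℝ) (hT : 0 ≤ T) :
    ∃ L : ℝ, 0 ≤ L ∧ ∀ m : ℕ, (4 + (m + 1) * T) ^ r * (1 / 2) ^ m ≤ L := by
  set N := ⌈r⌉₊
  have h := (tendsto_pow_const_mul_const_pow_of_abs_lt_one N (r := (1 / 2 : ℝ))
    (by rw [abs_of_pos] <;> norm_num)).comp (tendsto_add_atTop_nat 1)
  obtain ⟨B, hB⟩ := h.bddAbove_range
  have hB' : ∀ m : ℕ, ((m : ℝ) + 1) ^ N * (1 / 2) ^ (m + 1) ≤ B := fun m => by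
    have := hB ⟨m, rfl⟩
    simpa using this
  have hB0 : 0 ≤ B := le_trans (by positivity) (hB' 0)
  refine ⟨(4 + T) ^ N * (2 * B), by positivity, fun m => ?_⟩
  have h1 : (4 + (m + 1) * T) ^ r ≤ (4 + (m + 1) * T) ^ N := by
    rw [← Real.rpow_natCast]
    refine Real.rpow_le_rpow_of_exponent_le ?_ (Nat.le_ceil r)
    have : 0 ≤ (m + 1) * T := by positivity
    linarith
  have h2 : (4 + ((m : ℝ) + 1) * T) ^ N ≤ ((4 + T) * (m + 1)) ^ N := by
    gcongr
    have : (0 : ℝ) ≤ m := Nat.cast_nonneg m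
    nlinarith
  calc (4 + (m + 1) * T) ^ r * (1 / 2) ^ m ≤ ((4 + T) * (m + 1)) ^ N * (1 / 2) ^ m := by
        gcongr; exact h1.trans h2
    _ = (4 + T) ^ N * (2 * ((m + 1) ^ N * (1 / 2) ^ (m + 1))) := by
        rw [mul_pow, pow_succ]; ring
    _ ≤ _ := by gcongr; exact hB' m

/-- Only polynomial decay faster than `α ^ (-p)` is needed later; the exponent `p + 1` leaves the
integrand `t ^ (-2)` at infinity. -/
theorem distribFun_le_rpow_of_geometric_decay {q p D : ℝ} (hq : 0 < q) (hp : 0 < p) (hD : 0 ≤ D) :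
    ∃ K : ℝ, 0 ≤ K ∧ ∀ {X : Type*} [MeasurableSpace X] (μ : Measure X) (f : X → ℝ) (M : ℝ),
      0 ≤ M → (∀ α, 0 < α → distribFun f μ α ≤ ENNReal.ofReal (M * α ^ (-q))) →
      (∀ m : ℕ, 2 ^ m * distribFun f μ (4 + m * (D + 2)) ≤ 2 * distribFun f μ 2) →
      ∀ α, 1 ≤ α → distribFun f μ α ≤ ENNReal.ofReal (K * M * α ^ (-(p + 1))) := by
  obtain ⟨L, hL0, hL⟩ := exists_bound_rpow_mul_half_pow (p + 1) (D + 2) (by positivity)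
  -- The first term serves `1 ≤ α < 4`, where the weak bound suffices; the second serves `α ≥ 4`,
  -- where the geometric decay acts.
  refine ⟨4 ^ (p + 1) + 2 * L, by positivity, ?_⟩
  intro X _ μ f M hM hweak hgeom α hα
  have hα0 : 0 < α := by linarith
  have hαp : 0 < α ^ (-(p + 1)) := by positivity
  have hαe : α ^ (p + 1) * α ^ (-(p + 1)) = 1 := by
    rw [← Real.rpow_add hα0]; simp
  rcases lt_or_ge α 4 with h4 | h4
  · refine (hweak α hα0).trans (ENNReal.ofReal_le_ofReal ?_)
    have h1 : α ^ (-q) ≤ 1 := Real.rpow_le_one_of_one_le_of_nonpos hα (by linarith)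
    have h2 : α ^ (p + 1) ≤ (4 : ℝ) ^ (p + 1) :=
      Real.rpow_le_rpow hα0.le h4.le (by linarith)
    calc M * α ^ (-q) ≤ M * 1 := by gcongr
      _ = α ^ (p + 1) * M * α ^ (-(p + 1)) := by rw [mul_right_comm, hαe]; ring
      _ ≤ _ := by gcongr; linarith
  · set T := D + 2 with hT
    have hTp : 0 < T := by positivity
    -- The largest `m` whose level `4 + m * T` does not exceed `α`.
    set m := ⌊(α - 4) / T⌋₊ with hm
    have hm1 : 4 + m * T ≤ α := by
      have := Nat.floor_le (div_nonneg (sub_nonneg.2 h4) hTp.le)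
      rw [← hm, le_div_iff₀ hTp] at this
      linarith
    have hm2 : α ≤ 4 + (m + 1) * T := by
      have := (Nat.lt_floor_add_one ((α - 4) / T)).le
      rw [← hm, div_le_iff₀ hTp] at this
      linarith
    have h1 : 2 ^ m * distribFun f μ α ≤ ENNReal.ofReal (2 * M) := by
      calc 2 ^ m * distribFun f μ α ≤ 2 ^ m * distribFun f μ (4 + m * T) := by
            gcongr; exact distribFun_anti f μ hm1
        _ ≤ 2 * distribFun f μ 2 := hgeom m
        _ ≤ 2 * ENNReal.ofReal (M * 2 ^ (-q)) := by gcongr; exact hweak 2 (by norm_num)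
        _ ≤ 2 * ENNReal.ofReal (M * 1) := by
            gcongr
            exact Real.rpow_le_one_of_one_le_of_nonpos (by norm_num) (by linarith)
        _ = ENNReal.ofReal (2 * M) := by
            rw [mul_one, ENNReal.ofReal_mul (by norm_num)]; simp
    have h2 : distribFun f μ α ≤ ENNReal.ofReal (2 * M * (1 / 2) ^ m) := by
      have e : (2 : ℝ≥0∞) ^ m = ENNReal.ofReal (2 ^ m) := by
        rw [ENNReal.ofReal_pow (by norm_num)]; simp
      rw [e, mul_comm, ← ENNReal.le_div_iff_mul_le (by simp) (by simp),
        ← ENNReal.ofReal_div_of_pos (by positivity)] at h1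
      convert h1 using 2
      rw [one_div, inv_pow]; rfl
    refine h2.trans (ENNReal.ofReal_le_ofReal ?_)
    have h3 : (1 / 2 : ℝ) ^ m ≤ L * α ^ (-(p + 1)) := by
      have h5 : α ^ (p + 1) * (1 / 2) ^ m ≤ L := by
        refine le_trans ?_ (hL m)
        gcongr
      calc (1 / 2 : ℝ) ^ m = (α ^ (p + 1) * (1 / 2) ^ m) * α ^ (-(p + 1)) := by
            rw [mul_right_comm, hαe, one_mul]
        _ ≤ _ := by gcongr
    calc 2 * M * (1 / 2) ^ m ≤ 2 * M * (L * α ^ (-(p + 1))) := by gcongr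
      _ = 2 * L * M * α ^ (-(p + 1)) := by ring
      _ ≤ _ := by gcongr; linarith [show (0 : ℝ) ≤ 4 ^ (p + 1) by positivity]

/-- A weak type bound of exponent `q` and geometric decay of the distribution function imply
integrability of every larger power. -/
theorem lintegral_rpow_le_of_geometric_decay {q p D : ℝ} (hq : 0 < q) (hqp : q < p) (hD : 0 ≤ D) :
    ∃ K : ℝ≥0, ∀ {X : Type*} [MeasurableSpace X] (μ : Measure X) (f : X → ℝ) (M : ℝ),
      AEMeasurable f μ → 0 ≤ M →
      (∀ α, 0 < α → distribFun f μ α ≤ ENNReal.ofReal (M * α ^ (-q))) →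
      (∀ m : ℕ, 2 ^ m * distribFun f μ (4 + m * (D + 2)) ≤ 2 * distribFun f μ 2) →
      ∫⁻ x, ‖f x‖ₑ ^ p ∂μ ≤ K * ENNReal.ofReal M := by
  have hp : 0 < p := hq.trans hqp
  obtain ⟨K₁, hK₁0, hK₁⟩ := distribFun_le_rpow_of_geometric_decay hq hp hD
  -- Finite because `p - 1 - q > -1`: this is where `q < p` enters.
  have hI : (∫⁻ t in Set.Ioo (0 : ℝ) 1, ENNReal.ofReal (t ^ (p - 1 - q))) < ⊤ :=
    ((intervalIntegral.integrableOn_Ioo_rpow_iff one_pos).2 (by linarith)).lintegral_lt_top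
  have hJ : (∫⁻ t in Set.Ioi (1 : ℝ), ENNReal.ofReal (t ^ (-2 : ℝ))) < ⊤ :=
    (integrableOn_Ioi_rpow_of_lt (by norm_num) one_pos).lintegral_lt_top
  set I := ∫⁻ t in Set.Ioo (0 : ℝ) 1, ENNReal.ofReal (t ^ (p - 1 - q))
  set J := ∫⁻ t in Set.Ioi (1 : ℝ), ENNReal.ofReal (t ^ (-2 : ℝ))
  refine ⟨(ENNReal.ofReal p * (I + ENNReal.ofReal K₁ * J)).toNNReal, ?_⟩
  intro X _ μ f M hf hM hweak hgeom
  rw [ENNReal.coe_toNNReal (ENNReal.mul_ne_top ENNReal.ofReal_ne_top (ENNReal.add_ne_top.2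
    ⟨hI.ne, ENNReal.mul_ne_top ENNReal.ofReal_ne_top hJ.ne⟩))]
  have e : ∫⁻ x, ‖f x‖ₑ ^ p ∂μ = ∫⁻ x, ENNReal.ofReal (|f x| ^ p) ∂μ := by
    refine lintegral_congr fun x => ?_
    rw [Real.enorm_eq_ofReal_abs, ENNReal.ofReal_rpow_of_nonneg (abs_nonneg _) hp.le]
  rw [e, lintegral_rpow_eq_lintegral_meas_lt_mul μ (Eventually.of_forall fun x => abs_nonneg _)
    (by fun_prop) hp, mul_assoc]
  gcongr
  have hsplit : Set.Ioi (0 : ℝ) =ᵐ[volume] (Set.Ioo 0 1 ∪ Set.Ioi 1 : Set ℝ) := by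
    rw [← Set.Ioc_union_Ioi_eq_Ioi zero_le_one]
    exact ae_eq_set_union Ioo_ae_eq_Ioc.symm (ae_eq_refl _)
  rw [setLIntegral_congr hsplit]
  refine (lintegral_union_le _ _ _).trans ?_
  rw [add_mul]
  gcongr ?_ + ?_
  · rw [← lintegral_mul_const' _ _ ENNReal.ofReal_ne_top]
    refine setLIntegral_mono' measurableSet_Ioo fun t ht => ?_
    refine (mul_le_mul_left (hweak t ht.1) _).trans (le_of_eq ?_)
    rw [← ENNReal.ofReal_mul (by have := ht.1; positivity),
      ← ENNReal.ofReal_mul (by have := ht.1; positivity)]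
    congr 1
    rw [show p - 1 - q = -q + (p - 1) by ring, Real.rpow_add ht.1]
    ring
  · rw [mul_assoc, mul_comm J, ← mul_assoc,
      ← lintegral_const_mul' _ _ (ENNReal.mul_ne_top ENNReal.ofReal_ne_top ENNReal.ofReal_ne_top)]
    refine setLIntegral_mono' measurableSet_Ioi fun t ht => ?_
    have ht0 : (0 : ℝ) < t := one_pos.trans ht
    refine (mul_le_mul_left (hK₁ μ f M hM hweak hgeom t (le_of_lt ht)) _).trans (le_of_eq ?_)
    rw [← ENNReal.ofReal_mul (by positivity), ← ENNReal.ofReal_mul (by positivity),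
      ← ENNReal.ofReal_mul (by positivity)]
    congr 1
    rw [show (-2 : ℝ) = -(p + 1) + (p - 1) by ring, Real.rpow_add ht0]
    ring

/-! ### Cubes and dyadic cells -/

theorem axisCube_eq_preimage {n : ℕ} (a : EuclideanSpace ℝ (Fin n)) (s : ℝ) :
    axisCube a s = WithLp.ofLp ⁻¹' (Set.Icc (WithLp.ofLp a) fun i => a i + s) := by
  ext x
  simp only [axisCube, Set.mem_ofPred_eq, Set.mem_preimage, Set.mem_Icc, Pi.le_def]
  exact forall_and

theorem isCompact_axisCube {n : ℕ} (a : EuclideanSpace ℝ (Fin n)) (s : ℝ) :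
    IsCompact (axisCube a s) := by
  rw [axisCube_eq_preimage]
  exact (EuclideanSpace.equiv (Fin n) ℝ).toHomeomorph.isClosedEmbedding.isCompact_preimage
    isCompact_Icc

theorem measurableSet_axisCube {n : ℕ} (a : EuclideanSpace ℝ (Fin n)) (s : ℝ) :
    MeasurableSet (axisCube a s) :=
  (isCompact_axisCube a s).isClosed.measurableSet

theorem volume_axisCube {n : ℕ} (a : EuclideanSpace ℝ (Fin n)) (s : ℝ) :
    volume (axisCube a s) = ENNReal.ofReal s ^ n := by
  rw [axisCube_eq_preimage, (PiLp.volume_preserving_ofLp (Fin n)).measure_preimage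
    measurableSet_Icc.nullMeasurableSet, Real.volume_Icc_pi]
  simp

/-- The half-open cube with lowest corner `a` and side length `s`. -/
def halfOpenCube {n : ℕ} (a : EuclideanSpace ℝ (Fin n)) (s : ℝ) : Set (EuclideanSpace ℝ (Fin n)) :=
  {x | ∀ i, x i ∈ Set.Ico (a i) (a i + s)}

theorem halfOpenCube_ae_eq_axisCube {n : ℕ} (a : EuclideanSpace ℝ (Fin n)) (s : ℝ) :
    halfOpenCube a s =ᵐ[volume] axisCube a s := by
  have h : halfOpenCube a s = WithLp.ofLp ⁻¹'
      (Set.univ.pi fun i => Set.Ico (WithLp.ofLp a i) (a i + s)) := by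
    ext x; simp [halfOpenCube]
  rw [h, axisCube_eq_preimage]
  exact (PiLp.volume_preserving_ofLp (Fin n)).quasiMeasurePreserving.preimage_ae_eq
    Measure.univ_pi_Ico_ae_eq_Icc

theorem measurableSet_halfOpenCube {n : ℕ} (a : EuclideanSpace ℝ (Fin n)) (s : ℝ) :
    MeasurableSet (halfOpenCube a s) := by
  have : halfOpenCube a s = ⋂ i, (fun x : EuclideanSpace ℝ (Fin n) => x i) ⁻¹'
      Set.Ico (a i) (a i + s) := by
    ext x; simp [halfOpenCube]
  rw [this]
  exact MeasurableSet.iInter fun i => (by fun_prop : Measurable fun x : EuclideanSpace ℝ (Fin n) =>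
    x i) measurableSet_Ico

/-- Lebesgue differentiation along cubes that contain the point but need not be centred at it. -/
theorem ae_tendsto_average_axisCube {n : ℕ} {h : EuclideanSpace ℝ (Fin n) → ℝ}
    (hh : Integrable h volume) :
    ∀ᵐ x, ∀ (b : ℕ → EuclideanSpace ℝ (Fin n)) (r : ℕ → ℝ), (∀ k, 0 < r k) →
      Tendsto r atTop (𝓝 0) → (∀ k, x ∈ axisCube (b k) (r k)) →
      Tendsto (fun k => ⨍ y in axisCube (b k) (r k), h y) atTop (𝓝 (h x)) := by
  have hmp := PiLp.volume_preserving_ofLp (Fin n)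
  have hmp' := PiLp.volume_preserving_toLp (Fin n)
  have hemb : MeasurableEmbedding (WithLp.toLp 2 : (Fin n → ℝ) → EuclideanSpace ℝ (Fin n)) :=
    (MeasurableEquiv.toLp 2 (Fin n → ℝ)).measurableEmbedding
  -- Differentiation is carried out in `Fin n → ℝ`, where the balls of the sup norm are exactly the
  -- cubes.
  have hF : Integrable (fun z : Fin n → ℝ => h (WithLp.toLp 2 z)) volume :=
    (hmp'.integrable_comp_emb hemb).2 hh
  have hae := IsUnifLocDoublingMeasure.ae_tendsto_average (volume : Measure (Fin n → ℝ))
    hF.locallyIntegrable 1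
  have hae' := hmp.quasiMeasurePreserving.ae hae
  filter_upwards [hae'] with x hx b r hr hr0 hmem
  have hball : ∀ k, axisCube (b k) (r k) = WithLp.ofLp ⁻¹'
      Metric.closedBall (fun i => b k i + r k / 2) (r k / 2) := by
    intro k
    ext y
    rw [Set.mem_preimage, closedBall_pi _ (by have := hr k; positivity)]
    simp only [axisCube, Set.mem_ofPred_eq, Set.mem_univ_pi, Real.closedBall_eq_Icc]
    refine forall_congr' fun i => ?_
    rw [show b k i + r k / 2 - r k / 2 = b k i by ring,
      show b k i + r k / 2 + r k / 2 = b k i + r k by ring]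
  have key := hx (l := atTop) (fun k i => b k i + r k / 2) (fun k => r k / 2) (by
    refine tendsto_nhdsWithin_iff.2 ⟨by simpa using hr0.div_const 2, ?_⟩
    exact Eventually.of_forall fun k => half_pos (hr k)) (by
    refine Eventually.of_forall fun k => ?_
    have := hmem k
    rw [hball] at this
    simpa using this)
  refine key.congr fun k => ?_
  rw [setAverage_eq, setAverage_eq, hball k]
  have e : (WithLp.toLp 2 : (Fin n → ℝ) → EuclideanSpace ℝ (Fin n)) ⁻¹' (WithLp.ofLp ⁻¹'
      Metric.closedBall (fun i => b k i + r k / 2) (r k / 2)) =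
      Metric.closedBall (fun i => b k i + r k / 2) (r k / 2) := by ext z; simp
  have h1 := hmp'.setIntegral_preimage_emb hemb h
    (WithLp.ofLp ⁻¹' Metric.closedBall (fun i => b k i + r k / 2) (r k / 2))
  rw [e] at h1
  rw [h1, Measure.real, Measure.real, hmp.measure_preimage
    Metric.isClosed_closedBall.measurableSet.nullMeasurableSet]

/-- The index of the dyadic cell of generation `k` that contains `x`, for the dyadic grid
generated by the cube with corner `a` and side length `s`. -/
noncomputable def dyadicIndex {n : ℕ} (a : EuclideanSpace ℝ (Fin n)) (s : ℝ) (k : ℕ)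
    (x : EuclideanSpace ℝ (Fin n)) : Fin n → ℤ :=
  fun i => ⌊(x i - a i) / (s / 2 ^ k)⌋

/-- The lowest corner of a dyadic cell. -/
noncomputable def dyadicCorner {n : ℕ} (a : EuclideanSpace ℝ (Fin n)) (s : ℝ) (k : ℕ)
    (j : Fin n → ℤ) : EuclideanSpace ℝ (Fin n) :=
  WithLp.toLp 2 fun i => a i + j i * (s / 2 ^ k)

theorem dyadicIndex_preimage {n : ℕ} (a : EuclideanSpace ℝ (Fin n)) {s : ℝ} (hs : 0 < s) (k : ℕ)
    (j : Fin n → ℤ) :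
    dyadicIndex a s k ⁻¹' {j} = halfOpenCube (dyadicCorner a s k j) (s / 2 ^ k) := by
  ext x
  have hr : 0 < s / 2 ^ k := by positivity
  simp only [dyadicIndex, Set.mem_preimage, Set.mem_singleton_iff, halfOpenCube, dyadicCorner,
    Set.mem_ofPred_eq, funext_iff, Set.mem_Ico, Int.floor_eq_iff, le_div_iff₀ hr, div_lt_iff₀ hr]
  refine forall_congr' fun i => ?_
  constructor <;> rintro ⟨h1, h2⟩ <;> constructor <;> linarith

/-- The parent's index is the child's halved and rounded down, since `⌊u / 2⌋ = ⌊u⌋ / 2`. -/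
theorem dyadicIndex_refining {n : ℕ} (a : EuclideanSpace ℝ (Fin n)) (s : ℝ) (k : ℕ)
    (x y : EuclideanSpace ℝ (Fin n)) (h : dyadicIndex a s (k + 1) x = dyadicIndex a s (k + 1) y) :
    dyadicIndex a s k x = dyadicIndex a s k y := by
  funext i
  have key : ∀ z : EuclideanSpace ℝ (Fin n),
      dyadicIndex a s k z i = dyadicIndex a s (k + 1) z i / 2 := by
    intro z
    have := Int.floor_div_natCast ((z i - a i) / (s / 2 ^ (k + 1))) 2
    simp only [dyadicIndex]
    rw [show (2 : ℤ) = ((2 : ℕ) : ℤ) by rfl, ← this]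
    congr 1
    rw [pow_succ]; push_cast
    field_simp
  rw [key, key, h]

theorem dyadicIndex_zero {n : ℕ} (a : EuclideanSpace ℝ (Fin n)) {s : ℝ} (hs : 0 < s) :
    dyadicIndex a s 0 ⁻¹' {0} = halfOpenCube a s := by
  rw [dyadicIndex_preimage a hs]
  congr 1
  · ext i; simp [dyadicCorner]
  · simp

theorem axisCube_dyadicCorner_subset {n : ℕ} (a : EuclideanSpace ℝ (Fin n)) {s : ℝ} (hs : 0 < s)
    (k : ℕ) {x : EuclideanSpace ℝ (Fin n)} (hx : x ∈ halfOpenCube a s) :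
    axisCube (dyadicCorner a s k (dyadicIndex a s k x)) (s / 2 ^ k) ⊆ axisCube a s := by
  intro y hy i
  have hr : 0 < s / 2 ^ k := by positivity
  have hyi := hy i
  have hxi := hx i
  simp only [dyadicCorner, Set.mem_Icc, Set.mem_Ico] at hyi hxi ⊢
  have h0 : (0 : ℤ) ≤ dyadicIndex a s k x i :=
    Int.floor_nonneg.2 (div_nonneg (by linarith) hr.le)
  have h1 : dyadicIndex a s k x i + 1 ≤ 2 ^ k := by
    refine Int.add_one_le_iff.2 (Int.floor_lt.2 ?_)
    rw [div_lt_iff₀ hr]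
    push_cast
    rw [mul_div_cancel₀ _ (by positivity)]
    linarith
  have h0' : (0 : ℝ) ≤ dyadicIndex a s k x i := by exact_mod_cast h0
  have h1' : (dyadicIndex a s k x i : ℝ) + 1 ≤ 2 ^ k := by exact_mod_cast h1
  have h2 := mul_le_mul_of_nonneg_right h1' hr.le
  rw [mul_div_cancel₀ _ (by positivity : (2 : ℝ) ^ k ≠ 0)] at h2
  have h3 := mul_nonneg h0' hr.le
  constructor <;> linarith [hyi.1, hyi.2]

theorem dyadicIndex_preimage_subset {n : ℕ} (a : EuclideanSpace ℝ (Fin n)) {s : ℝ} (hs : 0 < s)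
    (k : ℕ) {x : EuclideanSpace ℝ (Fin n)} (hx : x ∈ halfOpenCube a s) :
    dyadicIndex a s k ⁻¹' {dyadicIndex a s k x} ⊆ halfOpenCube a s := by
  intro y hy
  rw [← dyadicIndex_zero a hs] at hx ⊢
  exact (eq_of_refining (dyadicIndex_refining a s) k.zero_le hy).trans hx

theorem restrict_restrict_dyadicCell {n : ℕ} (a : EuclideanSpace ℝ (Fin n)) {s : ℝ} (hs : 0 < s)
    (k : ℕ) {x : EuclideanSpace ℝ (Fin n)} (hx : x ∈ halfOpenCube a s) :
    (volume.restrict (axisCube a s)).restrict (dyadicIndex a s k ⁻¹' {dyadicIndex a s k x}) =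
      volume.restrict (axisCube (dyadicCorner a s k (dyadicIndex a s k x)) (s / 2 ^ k)) := by
  rw [← Measure.restrict_congr_set (halfOpenCube_ae_eq_axisCube a s),
    Measure.restrict_restrict
      (by rw [dyadicIndex_preimage a hs]; exact measurableSet_halfOpenCube _ _),
    Set.inter_eq_left.2 (dyadicIndex_preimage_subset a hs k hx), dyadicIndex_preimage a hs,
    Measure.restrict_congr_set (halfOpenCube_ae_eq_axisCube _ _)]

/-- The grid tiles all of space while the measure lives on one cube; conditions on cells are thereby
reduced to cells meeting that cube, all others being null. -/
theorem exists_mem_of_dyadicCell_ne_zero {n : ℕ} (a : EuclideanSpace ℝ (Fin n)) (s : ℝ)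
    (k : ℕ) (j : Fin n → ℤ)
    (h : volume.restrict (axisCube a s) (dyadicIndex a s k ⁻¹' {j}) ≠ 0) :
    ∃ x ∈ halfOpenCube a s, dyadicIndex a s k x = j := by
  rw [← Measure.restrict_congr_set (halfOpenCube_ae_eq_axisCube a s),
    Measure.restrict_apply' (measurableSet_halfOpenCube _ _)] at h
  obtain ⟨x, hx⟩ := nonempty_of_measure_ne_zero h
  exact ⟨x, hx.2, hx.1⟩

/-- Normalised form of the interpolation between weak Lebesgue spaces and bounded mean oscillation
on a cube. -/
theorem lintegral_rpow_axisCube_le_of_oscillation_le_one (n : ℕ) {q p : ℝ} (hq : 0 < q)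
    (hqp : q < p) :
    ∃ K : ℝ≥0, ∀ (f : EuclideanSpace ℝ (Fin n) → ℝ) (a : EuclideanSpace ℝ (Fin n)) (s M : ℝ),
      0 < s → 0 ≤ M → IntegrableOn f (axisCube a s) volume →
      (∀ a' s', 0 < s' → axisCube a' s' ⊆ axisCube a s →
        ∫⁻ x in axisCube a' s', ‖f x - ⨍ y in axisCube a' s', f y‖ₑ ≤ volume (axisCube a' s')) →
      |⨍ x in axisCube a s, f x| ≤ 4 →
      (∀ α, 0 < α → distribFun f (volume.restrict (axisCube a s)) α ≤
        ENNReal.ofReal (M * α ^ (-q))) →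
      ∫⁻ x in axisCube a s, ‖f x‖ₑ ^ p ≤ K * ENNReal.ofReal M := by
  -- A dyadic cell has `2 ^ n` times the volume of each of its children.
  obtain ⟨K, hK⟩ := lintegral_rpow_le_of_geometric_decay (D := 2 ^ n) hq hqp (by positivity)
  refine ⟨K, fun f a s M hs hM hf hosc havg hweak => ?_⟩
  refine hK _ f M hf.aestronglyMeasurable.aemeasurable hM hweak ?_
  have : IsFiniteMeasure (volume.restrict (axisCube a s)) :=
    ⟨by rw [Measure.restrict_apply_univ]; exact (isCompact_axisCube a s).measure_lt_top⟩
  have hcm : ∀ k j, MeasurableSet (dyadicIndex a s k ⁻¹' {j}) := fun k j => by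
    rw [dyadicIndex_preimage a hs]; exact measurableSet_halfOpenCube _ _
  have hmeas : ∀ k x, x ∈ halfOpenCube a s → volume.restrict (axisCube a s)
      (dyadicIndex a s k ⁻¹' {dyadicIndex a s k x}) = ENNReal.ofReal (s / 2 ^ k) ^ n := by
    intro k x hx
    rw [← Measure.restrict_apply_univ, restrict_restrict_dyadicCell a hs k hx,
      Measure.restrict_apply_univ, volume_axisCube]
  refine distribFun_le_of_bounded_oscillation hcm (dyadicIndex_refining a s) hf ?_
    (by positivity) ?_ ?_ ?_
  · intro k j
    by_cases h0 : volume.restrict (axisCube a s) (dyadicIndex a s k ⁻¹' {j}) = 0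
    · rw [Measure.restrict_eq_zero.2 h0]; simp
    obtain ⟨x, hx, rfl⟩ := exists_mem_of_dyadicCell_ne_zero a s k j h0
    rw [hmeas k x hx, restrict_restrict_dyadicCell a hs k hx, ← volume_axisCube]
    exact hosc _ _ (by positivity) (axisCube_dyadicCorner_subset a hs k hx)
  · intro k x
    by_cases h0 : volume.restrict (axisCube a s)
      (dyadicIndex a s k ⁻¹' {dyadicIndex a s k x}) = 0
    · rw [h0]; exact zero_le
    obtain ⟨y, hy, hyx⟩ := exists_mem_of_dyadicCell_ne_zero a s k _ h0
    have hx : x ∈ halfOpenCube a s := dyadicIndex_preimage_subset a hs k hy hyx.symm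
    rw [hmeas k x hx, hmeas (k + 1) x hx, ENNReal.ofReal_pow (by norm_num), ← mul_pow,
      ← ENNReal.ofReal_mul (by norm_num)]
    gcongr
    rw [pow_succ]
    field_simp
    exact le_rfl
  · intro j
    by_cases h0 : volume.restrict (axisCube a s) (dyadicIndex a s 0 ⁻¹' {j}) = 0
    · rw [setAverage_eq, Measure.restrict_eq_zero.2 h0]; simp
    obtain ⟨x, hx, rfl⟩ := exists_mem_of_dyadicCell_ne_zero a s 0 j h0
    have h1 : dyadicIndex a s 0 x = 0 := by rwa [← dyadicIndex_zero a hs] at hx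
    have h2 : axisCube (dyadicCorner a s 0 (dyadicIndex a s 0 x)) (s / 2 ^ 0) = axisCube a s := by
      rw [h1]; simp [axisCube, dyadicCorner]
    rw [restrict_restrict_dyadicCell a hs 0 hx, h2]
    exact havg
  -- `f` is integrable only on the cube, so differentiation is applied to its extension by zero;
  -- cells through points of the half-open cube stay inside, and the averages agree.
  · have hind : Integrable ((axisCube a s).indicator f) volume :=
      (integrable_indicator_iff (measurableSet_axisCube a s)).2 hf
    rw [← Measure.restrict_congr_set (halfOpenCube_ae_eq_axisCube a s),
      ae_restrict_iff' (measurableSet_halfOpenCube a s)]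
    filter_upwards [ae_tendsto_average_axisCube hind] with x hx hxa
    rw [Measure.restrict_congr_set (halfOpenCube_ae_eq_axisCube a s)]
    have hxa' : x ∈ axisCube a s := fun i => Set.Ico_subset_Icc_self (hxa i)
    have := hx (fun k => dyadicCorner a s k (dyadicIndex a s k x)) (fun k => s / 2 ^ k)
      (fun k => by positivity)
      (by
        have h := (tendsto_pow_atTop_nhds_zero_of_lt_one (r := (1 / 2 : ℝ)) (by norm_num)
          (by norm_num)).const_mul s
        rw [mul_zero] at h
        refine h.congr fun k => ?_
        rw [one_div, inv_pow, div_eq_mul_inv])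
      (fun k i => by
        have : x ∈ dyadicIndex a s k ⁻¹' {dyadicIndex a s k x} := rfl
        rw [dyadicIndex_preimage a hs] at this
        exact Set.Ico_subset_Icc_self (this i))
    rw [Set.indicator_of_mem hxa'] at this
    refine this.congr fun k => ?_
    rw [restrict_restrict_dyadicCell a hs k hxa]
    refine setAverage_congr_fun (measurableSet_axisCube _ _) (Eventually.of_forall fun y hy => ?_)
    exact Set.indicator_of_mem (axisCube_dyadicCorner_subset a hs k hxa hy) f

/-- Interpolation between weak Lebesgue spaces and bounded mean oscillation on a cube. -/
theorem lintegral_rpow_axisCube_le (n : ℕ) {q p : ℝ} (hq : 0 < q) (hqp : q < p) :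
    ∃ K : ℝ≥0, ∀ (f : EuclideanSpace ℝ (Fin n) → ℝ) (a : EuclideanSpace ℝ (Fin n)) (s B C : ℝ),
      0 < s → 0 < B → 0 < C → IntegrableOn f (axisCube a s) volume →
      (∀ a' s', 0 < s' → axisCube a' s' ⊆ axisCube a s →
        ⨍⁻ x in axisCube a' s', ‖f x - ⨍ y in axisCube a' s', f y‖ₑ ∂volume ≤
          ENNReal.ofReal B) →
      |⨍ x in axisCube a s, f x| ≤ 4 * B →
      (∀ α, 0 < α → distribFun f (volume.restrict (axisCube a s)) α ≤
        ENNReal.ofReal (C ^ q / α ^ q)) →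
      ∫⁻ x in axisCube a s, ‖f x‖ₑ ^ p ≤ K * ENNReal.ofReal (C ^ q * B ^ (p - q)) := by
  obtain ⟨K, hK⟩ := lintegral_rpow_axisCube_le_of_oscillation_le_one n hq hqp
  refine ⟨K, fun f a s B C hs hB hC hf hosc havg hweak => ?_⟩
  have hB' : (0 : ℝ) < B⁻¹ := inv_pos.2 hB
  have hav : ∀ S : Set (EuclideanSpace ℝ (Fin n)),
      ⨍ x in S, B⁻¹ * f x = B⁻¹ * ⨍ x in S, f x := by
    intro S
    rw [setAverage_eq, setAverage_eq, integral_const_mul, smul_eq_mul, smul_eq_mul]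
    ring
  -- Dividing by `B` normalises the oscillation and turns the weak constant into `C ^ q * B ^ (-q)`;
  -- undoing it costs `B ^ p`.
  have key := hK (fun x => B⁻¹ * f x) a s (C ^ q * B ^ (-q)) hs (by positivity) (hf.const_mul _)
    (by
      intro a' s' hs' hsub
      have h1 := hosc a' s' hs' hsub
      have hv0 : volume (axisCube a' s') ≠ 0 := by
        rw [volume_axisCube]; exact pow_ne_zero _ (by simpa using hs')
      have hvt : volume (axisCube a' s') ≠ ⊤ := (isCompact_axisCube a' s').measure_lt_top.ne
      rw [setLAverage_eq, ENNReal.div_le_iff hv0 hvt] at h1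
      rw [hav]
      calc ∫⁻ x in axisCube a' s', ‖B⁻¹ * f x - B⁻¹ * ⨍ y in axisCube a' s', f y‖ₑ
          = ENNReal.ofReal B⁻¹ * ∫⁻ x in axisCube a' s', ‖f x - ⨍ y in axisCube a' s', f y‖ₑ := by
            rw [← lintegral_const_mul' _ _ ENNReal.ofReal_ne_top]
            refine lintegral_congr fun x => ?_
            rw [← mul_sub, enorm_mul, Real.enorm_eq_ofReal hB'.le]
        _ ≤ ENNReal.ofReal B⁻¹ * (ENNReal.ofReal B * volume (axisCube a' s')) := by gcongr
        _ = volume (axisCube a' s') := by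
            rw [← mul_assoc, ← ENNReal.ofReal_mul hB'.le, inv_mul_cancel₀ hB.ne']; simp)
    (by
      rw [hav, abs_mul, abs_of_pos hB', inv_mul_le_iff₀ hB]
      linarith)
    (by
      intro α hα
      have h1 := hweak (B * α) (by positivity)
      have h2 : distribFun (fun x => B⁻¹ * f x) (volume.restrict (axisCube a s)) α =
          distribFun f (volume.restrict (axisCube a s)) (B * α) := by
        unfold distribFun
        congr 1
        ext x
        simp only [Set.mem_ofPred_eq]
        rw [abs_mul, abs_of_pos hB', lt_inv_mul_iff₀ hB]
      rw [h2]
      refine h1.trans (le_of_eq ?_)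
      congr 1
      rw [Real.mul_rpow hB.le hα.le, Real.rpow_neg hB.le, Real.rpow_neg hα.le]
      field_simp)
  have e : ∫⁻ x in axisCube a s, ‖f x‖ₑ ^ p = ENNReal.ofReal (B ^ p) *
      ∫⁻ x in axisCube a s, ‖B⁻¹ * f x‖ₑ ^ p := by
    rw [← lintegral_const_mul' _ _ ENNReal.ofReal_ne_top]
    refine lintegral_congr fun x => ?_
    rw [← ENNReal.ofReal_rpow_of_nonneg hB.le (by linarith),
      ← ENNReal.mul_rpow_of_nonneg _ _ (by linarith : 0 ≤ p), enorm_mul,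
      Real.enorm_eq_ofReal hB'.le, ← mul_assoc, ← ENNReal.ofReal_mul hB.le,
      mul_inv_cancel₀ hB.ne']
    simp
  rw [e]
  calc _ ≤ ENNReal.ofReal (B ^ p) * (K * ENNReal.ofReal (C ^ q * B ^ (-q))) := by gcongr
    _ = K * ENNReal.ofReal (C ^ q * B ^ (p - q)) := by
      rw [mul_left_comm, ← ENNReal.ofReal_mul (by positivity), sub_eq_add_neg, Real.rpow_add hB]
      congr 2
      ring

/-! ### Interpolation between weak Lebesgue spaces and `BMO` -/

/-- Passage from all admissible constants to the weak quasi-norm and the seminorm. -/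
theorem eLpNorm_le_of_forall_bounds {X : Type*} [MeasurableSpace X] {μ : Measure X} {f : X → ℝ}
    {q p : ℝ} (hq : 0 < q) (hqp : q < p) {K : ℝ≥0} {b : ℝ≥0∞} (hb : b < ⊤)
    (hw : weakLpNorm f q μ < ⊤)
    (h : ∀ B C : ℝ, 0 < B → 0 < C → b ≤ ENNReal.ofReal B →
      (∀ α, 0 < α → distribFun f μ α ≤ ENNReal.ofReal (C ^ q / α ^ q)) →
      ∫⁻ x, ‖f x‖ₑ ^ p ∂μ ≤ K * ENNReal.ofReal (C ^ q * B ^ (p - q))) :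
    eLpNorm f (ENNReal.ofReal p) μ ≤
      (K ^ (1 / p) : ℝ≥0) * weakLpNorm f q μ ^ (q / p) * b ^ (1 - q / p) := by
  have hp : 0 < p := hq.trans hqp
  have hqp1 : 0 < 1 - q / p := by rw [sub_pos, div_lt_one hp]; exact hqp
  set w := weakLpNorm f q μ with hwdef
  -- The infimum need not be attained, and `w` or `b` may vanish while `B` and `C` must be positive;
  -- both are enlarged by `1 / m` and the limit is taken.
  have hlim : Tendsto (fun m : ℕ => (K ^ (1 / p) : ℝ≥0) * (w + (m : ℝ≥0∞)⁻¹) ^ (q / p) *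
      (b + (m : ℝ≥0∞)⁻¹) ^ (1 - q / p)) atTop
      (𝓝 ((K ^ (1 / p) : ℝ≥0) * w ^ (q / p) * b ^ (1 - q / p))) := by
    have h1 : ∀ a : ℝ≥0∞, Tendsto (fun m : ℕ => a + (m : ℝ≥0∞)⁻¹) atTop (𝓝 a) := fun a => by
      simpa using tendsto_const_nhds.add ENNReal.tendsto_inv_nat_nhds_zero
    have h2 := ((ENNReal.continuous_rpow_const (y := q / p)).tendsto w).comp (h1 w)
    have h3 := ((ENNReal.continuous_rpow_const (y := 1 - q / p)).tendsto b).comp (h1 b)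
    have hw' : w ^ (q / p) ≠ ⊤ := ENNReal.rpow_ne_top_of_nonneg (by positivity) hw.ne
    have hb' : b ^ (1 - q / p) ≠ ⊤ := ENNReal.rpow_ne_top_of_nonneg hqp1.le hb.ne
    exact ENNReal.Tendsto.mul (ENNReal.Tendsto.const_mul h2 (Or.inr ENNReal.coe_ne_top))
      (Or.inr hb') h3 (Or.inr (ENNReal.mul_ne_top ENNReal.coe_ne_top hw'))
  refine ge_of_tendsto hlim ?_
  filter_upwards [eventually_gt_atTop 0] with m hm
  set ε : ℝ≥0∞ := (m : ℝ≥0∞)⁻¹ with hε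
  have hε0 : ε ≠ 0 := ENNReal.inv_ne_zero.2 (ENNReal.natCast_ne_top m)
  have hεt : ε ≠ ⊤ := ENNReal.inv_ne_top.2 (by exact_mod_cast hm.ne')
  have hlt : w < w + ε := ENNReal.lt_add_right hw.ne hε0
  obtain ⟨C, hC⟩ := iInf_lt_iff.1 (hwdef ▸ hlt : weakLpNorm f q μ < w + ε)
  obtain ⟨⟨hC0, hCw⟩, hClt⟩ := iInf_lt_iff.1 hC
  have hbt : b + ε ≠ ⊤ := ENNReal.add_ne_top.2 ⟨hb.ne, hεt⟩
  have hB0 : 0 < (b + ε).toReal := ENNReal.toReal_pos (by simp [hε0]) hbt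
  have key := h (b + ε).toReal C hB0 hC0 (by rw [ENNReal.ofReal_toReal hbt]; exact le_self_add) hCw
  have hp0 : ENNReal.ofReal p ≠ 0 := by simpa using hp
  rw [eLpNorm_eq_lintegral_rpow_enorm_toReal hp0 ENNReal.ofReal_ne_top, ENNReal.toReal_ofReal hp.le]
  calc (∫⁻ x, ‖f x‖ₑ ^ p ∂μ) ^ (1 / p)
      ≤ (K * ENNReal.ofReal (C ^ q * (b + ε).toReal ^ (p - q))) ^ (1 / p) := by gcongr
    _ = (K ^ (1 / p) : ℝ≥0) * ENNReal.ofReal C ^ (q / p) * (b + ε) ^ (1 - q / p) := by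
        rw [ENNReal.mul_rpow_of_nonneg _ _ (by positivity), ENNReal.ofReal_mul (by positivity),
          ENNReal.mul_rpow_of_nonneg _ _ (by positivity), ← ENNReal.ofReal_rpow_of_pos hC0,
          ← ENNReal.ofReal_rpow_of_pos hB0, ENNReal.ofReal_toReal hbt, ← ENNReal.rpow_mul,
          ← ENNReal.rpow_mul, mul_assoc, ENNReal.coe_rpow_of_nonneg _ (by positivity)]
        congr 4
        · ring
        · field_simp
    _ ≤ _ := by gcongr

/-- A function in `BMO` that satisfies a weak type bound has small averages on large cubes. -/
theorem abs_average_le_of_weak_bound {n : ℕ} {f : EuclideanSpace ℝ (Fin n) → ℝ} {q B C s : ℝ}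
    {a : EuclideanSpace ℝ (Fin n)} (hs : 0 < s) (hB : 0 < B)
    (hf : IntegrableOn f (axisCube a s) volume)
    (hbmo : ⨍⁻ x in axisCube a s, ‖f x - ⨍ y in axisCube a s, f y‖ₑ ∂volume ≤ ENNReal.ofReal B)
    (hweak : ∀ α, 0 < α → distribFun f volume α ≤ ENNReal.ofReal (C ^ q / α ^ q))
    (hlarge : 2 * ENNReal.ofReal (C ^ q / (2 * B) ^ q) < volume (axisCube a s)) :
    |⨍ x in axisCube a s, f x| ≤ 4 * B := by
  by_contra! hlt
  have hvt : volume (axisCube a s) ≠ ⊤ := (isCompact_axisCube a s).measure_lt_top.ne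
  have : IsFiniteMeasure (volume.restrict (axisCube a s)) :=
    ⟨by rw [Measure.restrict_apply_univ]; exact hvt.lt_top⟩
  have hv0 : volume (axisCube a s) ≠ 0 := by
    rw [volume_axisCube]; exact pow_ne_zero _ (by simpa using hs)
  rw [setLAverage_eq, ENNReal.div_le_iff hv0 hvt] at hbmo
  -- An average above `4 * B` would force `|f| > 2 * B` on half the cube, more than the weak bound
  -- permits on so large a cube.
  have key := measure_le_two_mul_of_average_large (μ := volume.restrict (axisCube a s)) (f := f)
    hf MeasurableSet.univ hB le_rfl (by simpa using hlt) (by simpa using hbmo)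
  rw [Measure.restrict_apply_univ, Set.univ_inter] at key
  have h2 : volume.restrict (axisCube a s) {x | 4 * B / 2 < |f x|} ≤
      ENNReal.ofReal (C ^ q / (2 * B) ^ q) := by
    rw [show 4 * B / 2 = 2 * B by ring]
    exact (Measure.restrict_apply_le _ _).trans (hweak _ (by positivity))
  exact absurd (key.trans (by gcongr)) (not_le.2 hlarge)

/-- Monotone convergence over the cubes `[-N, N]^n`, the cube estimate being uniform for large `N`.
Positive dimension makes their volumes grow without bound. -/
theorem lintegral_rpow_le_of_bmo (n : ℕ) (hn : 1 ≤ n) {q p : ℝ} (hq : 0 < q) (hqp : q < p) :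
    ∃ K : ℝ≥0, ∀ (f : EuclideanSpace ℝ (Fin n) → ℝ) (B C : ℝ), 0 < B → 0 < C →
      LocallyIntegrable f volume → bmoSeminorm f ≤ ENNReal.ofReal B →
      (∀ α, 0 < α → distribFun f volume α ≤ ENNReal.ofReal (C ^ q / α ^ q)) →
      ∫⁻ x, ‖f x‖ₑ ^ p ≤ K * ENNReal.ofReal (C ^ q * B ^ (p - q)) := by
  obtain ⟨K, hK⟩ := lintegral_rpow_axisCube_le n hq hqp
  refine ⟨K, fun f B C hB hC hf hbmo hweak => ?_⟩
  have hosc : ∀ a s, 0 < s → ⨍⁻ x in axisCube a s, ‖f x - ⨍ y in axisCube a s, f y‖ₑ ∂volume ≤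
      ENNReal.ofReal B := fun a s hs => by
    refine le_trans ?_ hbmo
    unfold bmoSeminorm
    exact le_iSup₂_of_le a s (le_iSup (fun _ : 0 < s => ⨍⁻ x in axisCube a s,
      ‖f x - ⨍ y in axisCube a s, f y‖ₑ ∂volume) hs)
  set Q : ℕ → Set (EuclideanSpace ℝ (Fin n)) := fun N =>
    axisCube (WithLp.toLp 2 fun _ => -(N : ℝ)) (2 * N) with hQ
  have hQmem : ∀ N x, x ∈ Q N ↔ ∀ i, |x i| ≤ N := by
    intro N x
    simp only [hQ, axisCube, Set.mem_ofPred_eq, Set.mem_Icc, abs_le]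
    refine forall_congr' fun i => ?_
    rw [show -(N : ℝ) + 2 * N = N by ring]
  have hmono : Monotone Q := by
    intro N M hNM x hx
    rw [hQmem] at hx ⊢
    exact fun i => (hx i).trans (Nat.cast_le.2 hNM)
  have hunion : ⋃ N, Q N = Set.univ := by
    refine Set.eq_univ_of_forall fun x => Set.mem_iUnion.2 ⟨⌈‖x‖⌉₊, (hQmem _ _).2 fun i => ?_⟩
    exact (PiLp.norm_apply_le x i).trans (Nat.le_ceil _)
  obtain ⟨N₀, hN₀⟩ := exists_nat_gt (2 * (C ^ q / (2 * B) ^ q))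
  have hlocal : ∀ N, N₀ + 1 ≤ N → ∫⁻ x in Q N, ‖f x‖ₑ ^ p ≤
      K * ENNReal.ofReal (C ^ q * B ^ (p - q)) := by
    intro N hN
    have hN1 : (N₀ : ℝ) + 1 ≤ N := by exact_mod_cast hN
    have hN0 : (0 : ℝ) ≤ N₀ := Nat.cast_nonneg _
    have hs : (0 : ℝ) < 2 * N := by linarith
    have hint : IntegrableOn f (Q N) volume := hf.integrableOn_isCompact (isCompact_axisCube _ _)
    refine hK f _ (2 * N) B C hs hB hC hint (fun a' s' hs' _ => hosc a' s' hs') ?_ ?_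
    · refine abs_average_le_of_weak_bound (q := q) (C := C) hs hB hint (hosc _ _ hs) hweak ?_
      rw [volume_axisCube]
      calc 2 * ENNReal.ofReal (C ^ q / (2 * B) ^ q)
          = ENNReal.ofReal (2 * (C ^ q / (2 * B) ^ q)) := by
            rw [ENNReal.ofReal_mul (by norm_num)]; simp
        _ < ENNReal.ofReal (2 * N) := (ENNReal.ofReal_lt_ofReal_iff hs).2 (by linarith)
        _ ≤ ENNReal.ofReal (2 * N) ^ n :=
            le_self_pow₀ (ENNReal.one_le_ofReal.2 (by linarith)) (by omega)
    · exact fun α hα => (Measure.restrict_apply_le _ _).trans (hweak α hα)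
  rw [← setLIntegral_univ, ← hunion, setLIntegral_iUnion_of_directed _ hmono.directed_le]
  refine iSup_le fun N => (lintegral_mono_set (hmono (le_max_left N (N₀ + 1)))).trans ?_
  exact hlocal _ (le_max_right _ _)

/-- Interpolation between `L^{q,∞}` and `BMO` on `ℝⁿ`. -/
theorem eLpNorm_le_weakLpNorm_mul_bmoSeminorm (n : ℕ) (hn : 1 ≤ n) {q p : ℝ} (hq : 0 < q)
    (hqp : q < p) :
    ∃ c : ℝ≥0, ∀ f : EuclideanSpace ℝ (Fin n) → ℝ, MemWeakLp f q volume → MemBMO f →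
      MemLp f (ENNReal.ofReal p) volume ∧
      eLpNorm f (ENNReal.ofReal p) volume ≤
        c * weakLpNorm f q volume ^ (q / p) * bmoSeminorm f ^ (1 - q / p) := by
  obtain ⟨K, hK⟩ := lintegral_rpow_le_of_bmo n hn hq hqp
  refine ⟨K ^ (1 / p), fun f hw hb => ?_⟩
  have hp : 0 < p := hq.trans hqp
  have key := eLpNorm_le_of_forall_bounds hq hqp (K := K) hb.2 hw.2
    fun B C hB hC hbB hC' => hK f B C hB hC hb.1 hbB hC'
  refine ⟨⟨hw.1, key.trans_lt (ENNReal.mul_lt_top (ENNReal.mul_lt_top ENNReal.coe_lt_top ?_) ?_)⟩,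
    key⟩
  · exact ENNReal.rpow_lt_top_of_nonneg (by positivity) hw.2.ne
  · exact ENNReal.rpow_lt_top_of_nonneg (by rw [sub_nonneg, div_le_one hp]; exact hqp.le) hb.2.ne

/-! ### Weak gradients and the Poincaré inequality on squares -/

section WeakGradient

variable {n : ℕ} {f : EuclideanSpace ℝ (Fin n) → ℝ}
  {g : EuclideanSpace ℝ (Fin n) → EuclideanSpace ℝ (Fin n)}

theorem IsWeakGradient.congr_ae (h : IsWeakGradient Set.univ f g)
    {f' : EuclideanSpace ℝ (Fin n) → ℝ}
    {g' : EuclideanSpace ℝ (Fin n) → EuclideanSpace ℝ (Fin n)}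
    (hf : f =ᵐ[volume] f') (hg : g =ᵐ[volume] g') : IsWeakGradient Set.univ f' g' := by
  refine ⟨?_, ?_, fun φ hφ i => ?_⟩
  · rw [locallyIntegrableOn_univ]
    exact (locallyIntegrableOn_univ.1 h.1).congr hf
  · rw [locallyIntegrableOn_univ]
    exact (locallyIntegrableOn_univ.1 h.2.1).congr hg
  · have := h.2.2 φ hφ i
    rw [Measure.restrict_univ] at this ⊢
    have e1 : ∫ x, f' x * (gradient φ x) i = ∫ x, f x * (gradient φ x) i :=
      integral_congr_ae (by filter_upwards [hf] with x hx; rw [hx])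
    have e2 : ∫ x, (g' x) i * φ x = ∫ x, (g x) i * φ x :=
      integral_congr_ae (by filter_upwards [hg] with x hx; rw [hx])
    rw [e1, e2, this]

theorem integrable_mul_of_locallyIntegrable (hf : LocallyIntegrable f volume)
    {φ : EuclideanSpace ℝ (Fin n) → ℝ} (hφ : Continuous φ) (hs : HasCompactSupport φ) :
    Integrable (fun x => f x * φ x) volume := by
  simpa [mul_comm] using hf.integrable_smul_left_of_hasCompactSupport hφ hs

theorem gradient_apply_eq_fderiv (φ : EuclideanSpace ℝ (Fin n) → ℝ) (x : EuclideanSpace ℝ (Fin n))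
    (i : Fin n) : (gradient φ x) i = fderiv ℝ φ x (EuclideanSpace.single i 1) := by
  rw [← inner_gradient_left, EuclideanSpace.inner_single_right]; simp

theorem continuous_gradient_apply {φ : EuclideanSpace ℝ (Fin n) → ℝ} (hφ : ContDiff ℝ ∞ φ)
    (i : Fin n) : Continuous fun x => (gradient φ x) i := by
  simp only [gradient_apply_eq_fderiv]
  exact (hφ.continuous_fderiv (by simp)).clm_apply continuous_const

theorem hasCompactSupport_gradient_apply {φ : EuclideanSpace ℝ (Fin n) → ℝ}
    (hs : HasCompactSupport φ) (i : Fin n) : HasCompactSupport fun x => (gradient φ x) i := by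
  simp only [gradient_apply_eq_fderiv]
  exact hs.fderiv_apply ℝ _

/-- The weak gradient tested in an arbitrary direction. -/
theorem IsWeakGradient.integral_mul_fderiv (h : IsWeakGradient Set.univ f g)
    {φ : EuclideanSpace ℝ (Fin n) → ℝ} (hφ : ContDiff ℝ ∞ φ) (hs : HasCompactSupport φ)
    (v : EuclideanSpace ℝ (Fin n)) :
    ∫ x, f x * fderiv ℝ φ x v = -∫ x, inner ℝ (g x) v * φ x := by
  have hfl := locallyIntegrableOn_univ.1 h.1
  have hgl := locallyIntegrableOn_univ.1 h.2.1
  have hinner : ∀ y : EuclideanSpace ℝ (Fin n), inner ℝ y v = ∑ i, v i * y i := fun y => by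
    simp [PiLp.inner_apply]
  have hi1 : ∀ i, Integrable (fun x => f x * (gradient φ x) i) volume := fun i =>
    integrable_mul_of_locallyIntegrable hfl (continuous_gradient_apply hφ i)
      (hasCompactSupport_gradient_apply hs i)
  have hi2 : ∀ i, Integrable (fun x => (g x) i * φ x) volume := fun i => by
    have h1 := hgl.integrable_smul_left_of_hasCompactSupport hφ.continuous hs
    have h2 := (EuclideanSpace.proj (𝕜 := ℝ) i).integrable_comp h1
    refine h2.congr (Eventually.of_forall fun x => ?_)
    simp [mul_comm]
  have e1 : ∀ x, f x * fderiv ℝ φ x v = ∑ i, v i * (f x * (gradient φ x) i) := fun x => by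
    rw [← inner_gradient_left, hinner, Finset.mul_sum]
    exact Finset.sum_congr rfl fun i _ => by ring
  have e2 : ∀ x, inner ℝ (g x) v * φ x = ∑ i, v i * ((g x) i * φ x) := fun x => by
    rw [hinner, Finset.sum_mul]
    exact Finset.sum_congr rfl fun i _ => by ring
  simp only [e1, e2]
  rw [integral_finsetSum _ fun i _ => (hi1 i).const_mul _,
    integral_finsetSum _ fun i _ => (hi2 i).const_mul _, ← Finset.sum_neg_distrib]
  refine Finset.sum_congr rfl fun i _ => ?_
  have := h.2.2 φ ⟨hφ, hs, Set.subset_univ _⟩ i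
  rw [Measure.restrict_univ] at this
  rw [integral_const_mul, integral_const_mul, this]
  ring

/-- Shearing by a multiple of a fixed vector preserves the product measure. -/
theorem measurePreserving_shear (v : EuclideanSpace ℝ (Fin n)) (τ : Measure ℝ) [SFinite τ] :
    MeasurePreserving (fun z : ℝ × EuclideanSpace ℝ (Fin n) => (z.1, z.2 + z.1 • v))
      (τ.prod volume) (τ.prod volume) :=
  (MeasurePreserving.id τ).skew_product (g := fun t x => x + t • v) (by fun_prop)
    (Eventually.of_forall fun t => (measurePreserving_add_right volume (t • v)).map_eq)

theorem integrable_shear {F : Type*} [NormedAddCommGroup F] {u : EuclideanSpace ℝ (Fin n) → F}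
    (hu : Integrable u volume) (v : EuclideanSpace ℝ (Fin n)) (τ : Measure ℝ) [IsFiniteMeasure τ] :
    Integrable (fun z : ℝ × EuclideanSpace ℝ (Fin n) => u (z.2 + z.1 • v)) (τ.prod volume) :=
  (measurePreserving_shear v τ).integrable_comp_of_integrable
    (g := fun z : ℝ × EuclideanSpace ℝ (Fin n) => u z.2) (hu.comp_snd τ)

/-- All translates of a compact set along a segment lie in one compact set. -/
theorem exists_isCompact_translates {K : Set (EuclideanSpace ℝ (Fin n))} (hK : IsCompact K)
    (v : EuclideanSpace ℝ (Fin n)) :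
    ∃ K', IsCompact K' ∧ ∀ x ∈ K, ∀ t ∈ Set.Icc (0 : ℝ) 1, x + t • v ∈ K' := by
  refine ⟨(fun z : EuclideanSpace ℝ (Fin n) × ℝ => z.1 + z.2 • v) '' (K ×ˢ Set.Icc (0 : ℝ) 1),
    (hK.prod isCompact_Icc).image (by fun_prop), fun x hx t ht => ⟨(x, t), ⟨hx, ht⟩, rfl⟩⟩

/-- For `x` in a compact set only the values of `g` on a larger compact set matter, so `g` can be
truncated and Fubini applied to an integrable function. -/
theorem locallyIntegrable_integral_segment (hg : LocallyIntegrable g volume)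
    (v : EuclideanSpace ℝ (Fin n)) :
    LocallyIntegrable (fun x => ∫ t in Set.Icc (0 : ℝ) 1, inner ℝ (g (x + t • v)) v) volume := by
  rw [locallyIntegrable_iff]
  intro K hK
  obtain ⟨K', hK', hmem⟩ := exists_isCompact_translates hK v
  have h1 : Integrable (K'.indicator fun x => inner ℝ (g x) v) volume :=
    (integrable_indicator_iff hK'.measurableSet).2
      ((hg.integrableOn_isCompact hK').inner_const v)
  have h2 := (integrable_shear h1 v (volume.restrict (Set.Icc (0 : ℝ) 1))).integral_prod_right
  refine (h2.integrableOn (s := K)).congr_fun (fun x hx => ?_) hK.measurableSet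
  exact setIntegral_congr_fun measurableSet_Icc fun t ht =>
    Set.indicator_of_mem (hmem x hx t ht) _

/-- A locally integrable function with a locally integrable weak gradient satisfies the fundamental
theorem of calculus along almost every translate of a segment. -/
theorem IsWeakGradient.ae_sub_eq_integral (h : IsWeakGradient Set.univ f g)
    (v : EuclideanSpace ℝ (Fin n)) :
    ∀ᵐ x, f (x + v) - f x = ∫ t in Set.Icc (0 : ℝ) 1, inner ℝ (g (x + t • v)) v := by
  have hfl := locallyIntegrableOn_univ.1 h.1
  have hgl := locallyIntegrableOn_univ.1 h.2.1
  have hfv : LocallyIntegrable (fun x => f (x + v)) volume := by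
    rw [locallyIntegrable_iff]
    intro K hK
    have := (measurePreserving_add_right volume v).integrableOn_comp_preimage
      (MeasurableEquiv.addRight v).measurableEmbedding (f := f) (s := (fun x => x + v) '' K)
    rw [Set.preimage_image_eq _ (add_left_injective v)] at this
    exact this.2 (hfl.integrableOn_isCompact (hK.image (by fun_prop)))
  refine ae_eq_of_integral_contDiff_smul_eq (hfv.sub hfl)
    (locallyIntegrable_integral_segment hgl v) fun φ hφ hs => ?_
  simp only [smul_eq_mul]
  set τ := volume.restrict (Set.Icc (0 : ℝ) 1) with hτ
  obtain ⟨K', hK', hmem⟩ := exists_isCompact_translates hs.isCompact v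
  have hφd : Differentiable ℝ φ := hφ.differentiable (by simp)
  have hfdc : Continuous fun x => fderiv ℝ φ x v :=
    (hφ.continuous_fderiv (by simp)).clm_apply continuous_const
  have hfds : HasCompactSupport fun x => fderiv ℝ φ x v := hs.fderiv_apply ℝ v
  -- both double integrals converge absolutely
  have hI1 : Integrable (fun z : ℝ × EuclideanSpace ℝ (Fin n) =>
      f z.2 * fderiv ℝ φ (z.2 - z.1 • v) v) (τ.prod volume) := by
    have h1 : Integrable (fun z : ℝ × EuclideanSpace ℝ (Fin n) => K'.indicator f z.2)
        (τ.prod volume) :=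
      ((integrable_indicator_iff hK'.measurableSet).2
        (hfl.integrableOn_isCompact hK')).comp_snd τ
    obtain ⟨C, hC⟩ := hfds.exists_bound_of_continuous hfdc
    have h2 := h1.mul_bdd (c := C) (g := fun z => fderiv ℝ φ (z.2 - z.1 • v) v)
      (hfdc.comp (by fun_prop)).aestronglyMeasurable (Eventually.of_forall fun z => hC _)
    refine h2.congr ?_
    have hae : ∀ᵐ z ∂(τ.prod (volume : Measure (EuclideanSpace ℝ (Fin n)))),
        z.1 ∈ Set.Icc (0 : ℝ) 1 :=
      Measure.quasiMeasurePreserving_fst.ae (ae_restrict_mem measurableSet_Icc)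
    filter_upwards [hae] with z hz
    by_cases hzK : z.2 ∈ K'
    · rw [Set.indicator_of_mem hzK]
    · have : z.2 - z.1 • v ∉ tsupport φ := fun hx => hzK (by simpa using hmem _ hx _ hz)
      rw [image_eq_zero_of_notMem_tsupport (f := fun x => fderiv ℝ φ x v)
        fun hx => this (tsupport_fderiv_apply_subset ℝ v hx)]
      simp
  have hI2 : Integrable (fun z : ℝ × EuclideanSpace ℝ (Fin n) =>
      φ z.2 * inner ℝ (g (z.2 + z.1 • v)) v) (τ.prod volume) := by
    have h1 : Integrable (K'.indicator fun x => inner ℝ (g x) v) volume :=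
      (integrable_indicator_iff hK'.measurableSet).2
        ((hgl.integrableOn_isCompact hK').inner_const v)
    obtain ⟨C, hC⟩ := hs.exists_bound_of_continuous hφ.continuous
    have h2 := (integrable_shear h1 v τ).bdd_mul (c := C) (f := fun z => φ z.2)
      (hφ.continuous.comp continuous_snd).aestronglyMeasurable (Eventually.of_forall fun z => hC _)
    refine h2.congr ?_
    have hae : ∀ᵐ z ∂(τ.prod (volume : Measure (EuclideanSpace ℝ (Fin n)))),
        z.1 ∈ Set.Icc (0 : ℝ) 1 :=
      Measure.quasiMeasurePreserving_fst.ae (ae_restrict_mem measurableSet_Icc)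
    filter_upwards [hae] with z hz
    by_cases hzK : z.2 ∈ tsupport φ
    · rw [Set.indicator_of_mem (hmem _ hzK _ hz)]
    · rw [image_eq_zero_of_notMem_tsupport hzK]; simp
  -- The weak gradient identity tested with the translate of `φ` by `t • v`. Integrating over `t`
  -- and swapping the integrals, the left side telescopes by `hline` and the right side becomes the
  -- claimed segment integral.
  have hslice : ∀ t : ℝ, ∫ x, f x * fderiv ℝ φ (x - t • v) v =
      -∫ x, φ x * inner ℝ (g (x + t • v)) v := by
    intro t
    have h1 := h.integral_mul_fderiv (φ := fun x => φ (x - t • v))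
      (hφ.comp (contDiff_id.sub contDiff_const))
      (hs.comp_homeomorph (Homeomorph.subRight (t • v))) v
    simp only [fderiv_comp_sub] at h1
    rw [h1, ← integral_add_right_eq_self _ (t • v)]
    congr 1
    refine integral_congr_ae (Eventually.of_forall fun x => ?_)
    simp [mul_comm]
  have hline : ∀ x, ∫ t, f x * fderiv ℝ φ (x - t • v) v ∂τ =
      f x * φ x - f x * φ (x - v) := by
    intro x
    rw [hτ, integral_const_mul, ← mul_sub, integral_Icc_eq_integral_Ioc,
      ← intervalIntegral.integral_of_le zero_le_one]
    congr 1
    have hd : ∀ t ∈ Set.uIcc (0 : ℝ) 1, HasDerivAt (fun t : ℝ => -φ (x - t • v))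
        (fderiv ℝ φ (x - t • v) v) t := by
      intro t _
      have h1 : HasDerivAt (fun t : ℝ => x - t • v) (-v) t := by
        simpa using ((hasDerivAt_id t).smul_const v).const_sub x
      simpa [Function.comp_def, Pi.neg_def] using
        ((hφd (x - t • v)).hasFDerivAt.comp_hasDerivAt t h1).neg
    rw [intervalIntegral.integral_eq_sub_of_hasDerivAt hd
      ((hfdc.comp (by fun_prop)).intervalIntegrable _ _)]
    simp
    ring
  have hA : Integrable (fun x => φ x * f (x + v)) volume :=
    hfv.integrable_smul_left_of_hasCompactSupport hφ.continuous hs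
  have hA' : Integrable (fun x => φ x * f x) volume :=
    hfl.integrable_smul_left_of_hasCompactSupport hφ.continuous hs
  have hB : ∫ x, φ x * f (x + v) = ∫ x, f x * φ (x - v) := by
    rw [← integral_sub_right_eq_self _ v]
    refine integral_congr_ae (Eventually.of_forall fun x => ?_)
    simp [mul_comm]
  have hBi : Integrable (fun x => f x * φ (x - v)) volume := by
    refine (hA.comp_sub_right v).congr (Eventually.of_forall fun x => ?_)
    simp [mul_comm]
  have hs1 := integral_integral_swap (f := fun t x => f x * fderiv ℝ φ (x - t • v) v) hI1
  have hs2 := integral_integral_swap (f := fun t x => φ x * inner ℝ (g (x + t • v)) v) hI2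
  simp only [hslice, hline, integral_neg] at hs1
  simp only [integral_const_mul] at hs2
  have hA'' : Integrable (fun x => f x * φ x) volume := by simpa only [mul_comm] using hA'
  rw [integral_sub hA'' hBi] at hs1
  simp only [mul_sub]
  rw [← hs2, integral_sub hA hA', hB]
  simp only [mul_comm (φ _) (f _)]
  linarith

end WeakGradient

section Poincare

variable {n : ℕ} {f : EuclideanSpace ℝ (Fin n) → ℝ}
  {g : EuclideanSpace ℝ (Fin n) → EuclideanSpace ℝ (Fin n)}

/-- The translation difference quotient on a convex set is controlled by the weak gradient. -/
theorem IsWeakGradient.lintegral_sub_translate_le (h : IsWeakGradient Set.univ f g)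
    (hg : Measurable g) {Q : Set (EuclideanSpace ℝ (Fin n))} (hQ : Convex ℝ Q)
    (hQm : MeasurableSet Q) (v : EuclideanSpace ℝ (Fin n)) :
    ∫⁻ x in Q ∩ (fun x => x + v) ⁻¹' Q, ‖f x - f (x + v)‖ₑ ≤ ‖v‖ₑ * ∫⁻ x in Q, ‖g x‖ₑ := by
  have hvm : MeasurableSet (Q ∩ (fun x => x + v) ⁻¹' Q) :=
    hQm.inter (hQm.preimage (measurable_add_const v))
  set τ := volume.restrict (Set.Icc (0 : ℝ) 1) with hτ
  set G : EuclideanSpace ℝ (Fin n) → ℝ≥0∞ := Q.indicator fun x => ‖v‖ₑ * ‖g x‖ₑ with hG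
  have hGm : Measurable G := (by fun_prop : Measurable fun x => ‖v‖ₑ * ‖g x‖ₑ).indicator hQm
  -- By convexity the segment from `x` to `x + v` stays in `Q`, so the gradient may be cut off
  -- there; translation invariance then makes every slice in `t` equal.
  have hpt : ∀ᵐ x, x ∈ Q ∩ (fun x => x + v) ⁻¹' Q →
      ‖f x - f (x + v)‖ₑ ≤ ∫⁻ t, G (x + t • v) ∂τ := by
    filter_upwards [h.ae_sub_eq_integral v] with x hx hxQ
    rw [← enorm_neg, neg_sub, hx]
    refine (enorm_integral_le_lintegral_enorm _).trans ?_
    refine setLIntegral_mono' measurableSet_Icc fun t ht => ?_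
    have hmem : x + t • v ∈ Q := by
      have := hQ hxQ.1 hxQ.2 (sub_nonneg.2 ht.2) ht.1 (by ring)
      convert this using 1
      simp only [smul_add, sub_smul, one_smul]
      abel
    rw [hG, Set.indicator_of_mem hmem, mul_comm]
    have := norm_inner_le_norm (𝕜 := ℝ) (g (x + t • v)) v
    rw [← ofReal_norm, ← ofReal_norm, ← ofReal_norm, ← ENNReal.ofReal_mul (norm_nonneg _)]
    exact ENNReal.ofReal_le_ofReal this
  calc ∫⁻ x in Q ∩ (fun x => x + v) ⁻¹' Q, ‖f x - f (x + v)‖ₑ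
      ≤ ∫⁻ x in Q ∩ (fun x => x + v) ⁻¹' Q, ∫⁻ t, G (x + t • v) ∂τ :=
        setLIntegral_mono_ae' hvm hpt
    _ ≤ ∫⁻ x, ∫⁻ t, G (x + t • v) ∂τ := setLIntegral_le_lintegral _ _
    _ = ∫⁻ t, ∫⁻ x, G (x + t • v) ∂volume ∂τ :=
        lintegral_lintegral_swap (by
          refine Measurable.aemeasurable ?_
          exact hGm.comp (by fun_prop))
    _ = ∫⁻ t, ∫⁻ x, G x ∂volume ∂τ := by simp_rw [lintegral_add_right_eq_self]
    _ = ‖v‖ₑ * ∫⁻ x in Q, ‖g x‖ₑ := by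
        rw [lintegral_const, hτ, Measure.restrict_apply_univ, Real.volume_Icc, hG,
          lintegral_indicator hQm, lintegral_const_mul _ (by fun_prop)]
        simp

/-- The double oscillation on a convex set is controlled by the weak gradient. -/
theorem IsWeakGradient.lintegral_lintegral_sub_le (h : IsWeakGradient Set.univ f g)
    (hf : Measurable f) (hg : Measurable g) {Q D : Set (EuclideanSpace ℝ (Fin n))}
    (hQ : Convex ℝ Q) (hQm : MeasurableSet Q) (hDm : MeasurableSet D)
    (hD : ∀ x ∈ Q, ∀ y ∈ Q, y - x ∈ D) {r : ℝ≥0∞} (hr : ∀ v ∈ D, ‖v‖ₑ ≤ r) :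
    ∫⁻ x in Q, ∫⁻ y in Q, ‖f x - f y‖ₑ ≤ r * volume D * ∫⁻ x in Q, ‖g x‖ₑ := by
  set H : EuclideanSpace ℝ (Fin n) → EuclideanSpace ℝ (Fin n) → ℝ≥0∞ := fun x v =>
    (Q.indicator 1 x : ℝ≥0∞) * (Q.indicator 1 (x + v) * ‖f x - f (x + v)‖ₑ) with hH
  have hHm : Measurable (Function.uncurry H) := by
    have h1 : Measurable (Q.indicator (1 : EuclideanSpace ℝ (Fin n) → ℝ≥0∞)) :=
      measurable_one.indicator hQm
    have h2 : Measurable fun z : EuclideanSpace ℝ (Fin n) × EuclideanSpace ℝ (Fin n) =>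
      z.1 + z.2 := by fun_prop
    exact (h1.comp measurable_fst).mul ((h1.comp h2).mul
      ((hf.comp measurable_fst).sub (hf.comp h2)).enorm)
  have e1 : ∀ (s : Set (EuclideanSpace ℝ (Fin n))) (_ : MeasurableSet s)
      (u : EuclideanSpace ℝ (Fin n) → ℝ≥0∞),
      ∫⁻ x in s, u x = ∫⁻ x, (s.indicator 1 x : ℝ≥0∞) * u x := fun s hs u => by
    rw [← lintegral_indicator hs]
    refine lintegral_congr fun x => ?_
    by_cases hx : x ∈ s <;> simp [hx]
  -- Substitute `y = x + v` and integrate over `x` first; only displacements `v` in `D` contribute.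
  have e2 : ∫⁻ x in Q, ∫⁻ y in Q, ‖f x - f y‖ₑ = ∫⁻ v, ∫⁻ x, H x v := by
    rw [lintegral_lintegral_swap (f := fun v x => H x v)
      (hHm.comp measurable_swap).aemeasurable, e1 Q hQm]
    refine lintegral_congr fun x => ?_
    rw [e1 Q hQm, ← lintegral_add_left_eq_self _ x, hH, lintegral_const_mul']
    by_cases hx : x ∈ Q <;> simp [hx]
  have e3 : ∀ v, ∫⁻ x, H x v ≤ D.indicator (fun _ => r * ∫⁻ x in Q, ‖g x‖ₑ) v := by
    intro v
    have hvm : MeasurableSet (Q ∩ (fun x => x + v) ⁻¹' Q) :=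
      hQm.inter (hQm.preimage (measurable_add_const v))
    have e4 : ∫⁻ x, H x v = ∫⁻ x in Q ∩ (fun x => x + v) ⁻¹' Q, ‖f x - f (x + v)‖ₑ := by
      rw [e1 _ hvm]
      refine lintegral_congr fun x => ?_
      by_cases hx : x ∈ Q <;> by_cases hxv : x + v ∈ Q <;> simp [hH, hx, hxv]
    rw [e4]
    by_cases hv : v ∈ D
    · rw [Set.indicator_of_mem hv]
      exact (h.lintegral_sub_translate_le hg hQ hQm v).trans (by gcongr; exact hr v hv)
    · have : Q ∩ (fun x => x + v) ⁻¹' Q = ∅ := by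
        refine Set.eq_empty_of_forall_notMem fun x hx => hv ?_
        simpa using hD x hx.1 (x + v) hx.2
      simp [this]
  rw [e2]
  refine (lintegral_mono e3).trans ?_
  rw [lintegral_indicator hDm, lintegral_const, Measure.restrict_apply_univ]
  exact le_of_eq (by ring)

end Poincare

/-- The deviation `f x - ⨍ f` is the average over `y` of `f x - f y`. -/
theorem lintegral_sub_average_le {X : Type*} [MeasurableSpace X] {μ : Measure X}
    [IsFiniteMeasure μ] {f : X → ℝ} (hf : Integrable f μ) :
    μ Set.univ * ∫⁻ x, ‖f x - ⨍ y, f y ∂μ‖ₑ ∂μ ≤ ∫⁻ x, ∫⁻ y, ‖f x - f y‖ₑ ∂μ ∂μ := by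
  rw [← lintegral_const_mul' _ _ (measure_ne_top _ _)]
  refine lintegral_mono fun x => ?_
  have h1 : ∫ y, (f x - f y) ∂μ = μ.real Set.univ * (f x - ⨍ y, f y ∂μ) := by
    rw [integral_sub (integrable_const _) hf, mul_sub, ← smul_eq_mul _ (⨍ y, f y ∂μ),
      measure_smul_average]
    simp
  calc μ Set.univ * ‖f x - ⨍ y, f y ∂μ‖ₑ = ‖∫ y, (f x - f y) ∂μ‖ₑ := by
        rw [h1, enorm_mul, Real.enorm_eq_ofReal measureReal_nonneg, ofReal_measureReal]
    _ ≤ _ := enorm_integral_le_lintegral_enorm _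

theorem convex_axisCube {n : ℕ} (a : EuclideanSpace ℝ (Fin n)) (s : ℝ) :
    Convex ℝ (axisCube a s) := by
  intro x hx y hy t u ht hu htu i
  have := convex_Icc (a i) (a i + s) (hx i) (hy i) ht hu htu
  simpa using this

theorem lintegral_enorm_le_sqrt_mul {X : Type*} [MeasurableSpace X] {μ : Measure X}
    {F : Type*} [NormedAddCommGroup F] {g : X → F} (hg : AEStronglyMeasurable g μ) :
    ∫⁻ x, ‖g x‖ₑ ∂μ ≤ eLpNorm g 2 μ * μ Set.univ ^ (1 / 2 : ℝ) := by
  have := eLpNorm_le_eLpNorm_mul_rpow_measure_univ (p := 1) (q := 2) (by norm_num) hg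
  rw [eLpNorm_one_eq_lintegral_enorm] at this
  norm_num at this ⊢
  exact this

/-- Poincaré inequality on squares, in the form of a bound for the mean oscillation. -/
theorem IsWeakGradient.laverage_oscillation_le {f : EuclideanSpace ℝ (Fin 2) → ℝ}
    {g : EuclideanSpace ℝ (Fin 2) → EuclideanSpace ℝ (Fin 2)}
    (h : IsWeakGradient Set.univ f g) (a : EuclideanSpace ℝ (Fin 2)) {s : ℝ} (hs : 0 < s) :
    ⨍⁻ x in axisCube a s, ‖f x - ⨍ y in axisCube a s, f y‖ₑ ∂volume ≤
      8 * eLpNorm g 2 (volume.restrict (axisCube a s)) := by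
  have hfl := locallyIntegrableOn_univ.1 h.1
  have hgl := locallyIntegrableOn_univ.1 h.2.1
  wlog hm : Measurable f ∧ Measurable g generalizing f g
  · have hf' := hfl.aestronglyMeasurable
    have hg' := hgl.aestronglyMeasurable
    have h' := h.congr_ae hf'.ae_eq_mk hg'.ae_eq_mk
    have key := this h' (locallyIntegrableOn_univ.1 h'.1) (locallyIntegrableOn_univ.1 h'.2.1)
      ⟨hf'.stronglyMeasurable_mk.measurable, hg'.stronglyMeasurable_mk.measurable⟩
    have e1 : ⨍ y in axisCube a s, f y = ⨍ y in axisCube a s, hf'.mk f y :=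
      average_congr (ae_restrict_of_ae hf'.ae_eq_mk)
    rw [eLpNorm_congr_ae (ae_restrict_of_ae hg'.ae_eq_mk), e1]
    refine le_trans (le_of_eq (laverage_congr (ae_restrict_of_ae ?_))) key
    filter_upwards [hf'.ae_eq_mk] with x hx
    rw [hx]
  have hvt : volume (axisCube a s) ≠ ⊤ := (isCompact_axisCube a s).measure_lt_top.ne
  have : IsFiniteMeasure (volume.restrict (axisCube a s)) :=
    ⟨by rw [Measure.restrict_apply_univ]; exact hvt.lt_top⟩
  have hs0 : ENNReal.ofReal s ≠ 0 := by simpa using hs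
  have hst : ENNReal.ofReal s ≠ ⊤ := ENNReal.ofReal_ne_top
  have h1 := lintegral_sub_average_le (hfl.integrableOn_isCompact (isCompact_axisCube a s))
  -- Displacements lie in `[-s, s]²`, of area `(2s)²`, and have length at most `2s`. With
  -- Cauchy–Schwarz the double oscillation is at most `8 s⁴` times the `L²` norm; dividing by `s⁴`
  -- removes the scale.
  have h2 := h.lintegral_lintegral_sub_le hm.1 hm.2 (convex_axisCube a s)
    (measurableSet_axisCube a s) (measurableSet_axisCube (WithLp.toLp 2 fun _ => -s) (2 * s))
    (by
      intro x hx y hy i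
      have h1 := hx i
      have h2 := hy i
      simp only [Set.mem_Icc, PiLp.sub_apply] at h1 h2 ⊢
      constructor <;> linarith)
    (r := 2 * ENNReal.ofReal s) (by
      intro v hv
      have h0 : |v 0| ≤ s := abs_le.2 ⟨(hv 0).1, by have := (hv 0).2; simp at this; linarith⟩
      have h1 : |v 1| ≤ s := abs_le.2 ⟨(hv 1).1, by have := (hv 1).2; simp at this; linarith⟩
      have h2 : ‖v‖ ≤ 2 * s := by
        rw [EuclideanSpace.norm_eq, Real.sqrt_le_left (by positivity), Fin.sum_univ_two]
        simp only [Real.norm_eq_abs]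
        nlinarith [abs_nonneg (v 0), abs_nonneg (v 1)]
      rw [← ofReal_norm]
      refine (ENNReal.ofReal_le_ofReal h2).trans (le_of_eq ?_)
      rw [ENNReal.ofReal_mul (by norm_num)]; simp)
  have h3 := lintegral_enorm_le_sqrt_mul (μ := volume.restrict (axisCube a s))
    hgl.aestronglyMeasurable.restrict
  rw [Measure.restrict_apply_univ, volume_axisCube] at h1 h3
  rw [volume_axisCube, ENNReal.ofReal_mul (by norm_num)] at h2
  rw [setLAverage_eq, volume_axisCube]
  have e : (ENNReal.ofReal s ^ 2) ^ (1 / 2 : ℝ) = ENNReal.ofReal s := by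
    rw [← ENNReal.rpow_natCast, ← ENNReal.rpow_mul]; norm_num
  rw [e] at h3
  set S := ENNReal.ofReal s
  set L := eLpNorm g 2 (volume.restrict (axisCube a s))
  rw [ENNReal.div_le_iff (pow_ne_zero _ hs0) (ENNReal.pow_ne_top hst)]
  have h4 := h1.trans (h2.trans (mul_le_mul_right h3 _))
  have e' : 2 * S * (ENNReal.ofReal 2 * S) ^ 2 * (L * S) = S ^ 2 * (8 * L * S ^ 2) := by
    rw [show ENNReal.ofReal 2 = 2 by simp]; ring
  rw [e'] at h4
  exact (ENNReal.mul_le_mul_iff_right (pow_ne_zero _ hs0) (ENNReal.pow_ne_top hst)).1 h4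

/-- `Ḣ¹(ℝ²)` is contained in `BMO(ℝ²)`. -/
theorem MemHomH1.memBMO {f : EuclideanSpace ℝ (Fin 2) → ℝ}
    {g : EuclideanSpace ℝ (Fin 2) → EuclideanSpace ℝ (Fin 2)} (h : MemHomH1 f g) :
    MemBMO f ∧ bmoSeminorm f ≤ 8 * eLpNorm g 2 volume := by
  have hb : bmoSeminorm f ≤ 8 * eLpNorm g 2 volume := by
    unfold bmoSeminorm
    refine iSup_le fun a => iSup_le fun s => iSup_le fun hs => ?_
    refine (h.1.laverage_oscillation_le a hs).trans ?_
    gcongr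
    exact Measure.restrict_le_self
  exact ⟨⟨locallyIntegrableOn_univ.1 h.1.1,
    hb.trans_lt (ENNReal.mul_lt_top (by simp) h.2.2)⟩, hb⟩

/-! ### Extension by zero and the weak Ladyzhenskaya inequality -/

/-- Chebyshev's inequality. One is added to the norm because admissible constants must be strictly
positive. -/
theorem MemLp.weakLpNorm_two_lt_top {X : Type*} [MeasurableSpace X] {μ : Measure X} {f : X → ℝ}
    (hf : MemLp f 2 μ) : weakLpNorm f 2 μ < ⊤ := by
  set C := (eLpNorm f 2 μ).toReal + 1 with hC
  have hC0 : 0 < C := by positivity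
  refine lt_of_le_of_lt (iInf₂_le C ⟨hC0, fun α hα => ?_⟩) ENNReal.ofReal_lt_top
  have h1 := mul_meas_ge_le_pow_eLpNorm' μ (p := 2) (by norm_num) (by norm_num) hf.1
    (ENNReal.ofReal α)
  rw [ENNReal.toReal_ofNat, ENNReal.ofReal_rpow_of_pos hα] at h1
  have h2 : eLpNorm f 2 μ ≤ ENNReal.ofReal C := by
    rw [← ENNReal.ofReal_toReal hf.2.ne]
    exact ENNReal.ofReal_le_ofReal (by linarith)
  rw [ENNReal.ofReal_div_of_pos (by positivity), ENNReal.le_div_iff_mul_le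
    (Or.inl (by simpa using hα.ne')) (Or.inl ENNReal.ofReal_ne_top),
    mul_comm, ← ENNReal.ofReal_rpow_of_pos hC0]
  refine le_trans ?_ (h1.trans (by gcongr))
  unfold distribFun
  gcongr
  intro hx
  rw [Real.enorm_eq_ofReal_abs]
  exact ENNReal.ofReal_le_ofReal hx.le

theorem weakLpNorm_indicator {X : Type*} [MeasurableSpace X] {μ : Measure X} {Ω : Set X}
    (hΩ : MeasurableSet Ω) (f : X → ℝ) (q : ℝ) :
    weakLpNorm (Ω.indicator f) q μ = weakLpNorm f q (μ.restrict Ω) := by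
  have h : ∀ α : ℝ, 0 < α →
      distribFun (Ω.indicator f) μ α = distribFun f (μ.restrict Ω) α := by
    intro α hα
    unfold distribFun
    rw [Measure.restrict_apply' hΩ]
    congr 1
    ext x
    by_cases hx : x ∈ Ω <;> simp [hx, hα.le]
  unfold weakLpNorm
  refine iInf_congr fun C => iInf_congr_Prop (and_congr_right fun _ => ?_) fun _ => rfl
  exact forall₂_congr fun α hα => by rw [h α hα]

/-- On a finite measure `L²` convergence implies `L¹` convergence, which survives multiplication by
a bounded function. It carries integration by parts from test functions to their limits. -/
theorem tendsto_integral_mul_of_tendsto_eLpNorm_two {X : Type*} [MeasurableSpace X]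
    {μ : Measure X} [IsFiniteMeasure μ] {w : ℕ → X → ℝ} {w₀ u : X → ℝ}
    (hw : ∀ k, MemLp (w k) 2 μ) (hw₀ : MemLp w₀ 2 μ) (hu : AEStronglyMeasurable u μ) {M : ℝ}
    (hM : ∀ x, ‖u x‖ ≤ M)
    (hlim : Tendsto (fun k => eLpNorm (fun x => w k x - w₀ x) 2 μ) atTop (𝓝 0)) :
    Tendsto (fun k => ∫ x, w k x * u x ∂μ) atTop (𝓝 (∫ x, w₀ x * u x ∂μ)) := by
  have hint : ∀ {w : X → ℝ}, MemLp w 2 μ → Integrable (fun x => w x * u x) μ := fun hw =>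
    (hw.integrable (by norm_num)).mul_bdd hu (Eventually.of_forall hM)
  refine tendsto_integral_of_L1' _ (hint hw₀).aestronglyMeasurable (Eventually.of_forall fun k => hint (hw k)) ?_
  have hbound : ∀ k, eLpNorm ((fun x => w k x * u x) - fun x => w₀ x * u x) 1 μ ≤
      ENNReal.ofReal M * (eLpNorm (fun x => w k x - w₀ x) 2 μ * μ Set.univ ^ (1 / 2 : ℝ)) := by
    intro k
    rw [eLpNorm_one_eq_lintegral_enorm]
    calc ∫⁻ x, ‖((fun x => w k x * u x) - fun x => w₀ x * u x) x‖ₑ ∂μ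
        ≤ ∫⁻ x, ENNReal.ofReal M * ‖w k x - w₀ x‖ₑ ∂μ := by
          refine lintegral_mono fun x => ?_
          rw [Pi.sub_apply, ← sub_mul, enorm_mul, mul_comm]
          gcongr
          rw [← ofReal_norm]
          exact ENNReal.ofReal_le_ofReal (hM x)
      _ = ENNReal.ofReal M * ∫⁻ x, ‖w k x - w₀ x‖ₑ ∂μ :=
          lintegral_const_mul' _ _ ENNReal.ofReal_ne_top
      _ ≤ _ := by
          gcongr
          exact lintegral_enorm_le_sqrt_mul ((hw k).1.sub hw₀.1)
  refine tendsto_of_tendsto_of_tendsto_of_le_of_le tendsto_const_nhds ?_ (fun _ => zero_le) hbound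
  have h1 : μ Set.univ ^ (1 / 2 : ℝ) ≠ ⊤ :=
    ENNReal.rpow_ne_top_of_nonneg (by norm_num) (measure_ne_top _ _)
  have := ENNReal.Tendsto.const_mul (a := ENNReal.ofReal M)
    (ENNReal.Tendsto.mul_const hlim (Or.inr h1)) (Or.inr ENNReal.ofReal_ne_top)
  simpa using this

section Extension

variable {n : ℕ}

/-- Integration by parts between two test functions, one of which is supported in `Ω`. -/
theorem IsTestFunction.setIntegral_mul_gradient {Ω : Set (EuclideanSpace ℝ (Fin n))}
    {ψ φ : EuclideanSpace ℝ (Fin n) → ℝ} (hψ : IsTestFunction Ω ψ) (hφ : ContDiff ℝ ∞ φ)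
    (i : Fin n) :
    ∫ x in Ω, ψ x * (gradient φ x) i = -∫ x in Ω, (gradient ψ x) i * φ x := by
  have hψ0 : ∀ x, x ∉ Ω → x ∉ tsupport ψ := fun x hx h => hx (hψ.2.2 h)
  rw [setIntegral_eq_integral_of_forall_compl_eq_zero fun x hx => by
      rw [image_eq_zero_of_notMem_tsupport (hψ0 x hx), zero_mul],
    setIntegral_eq_integral_of_forall_compl_eq_zero fun x hx => by
      rw [gradient_apply_eq_fderiv, image_eq_zero_of_notMem_tsupport
        (f := fun x => fderiv ℝ ψ x (EuclideanSpace.single i 1))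
        fun h => hψ0 x hx (tsupport_fderiv_apply_subset ℝ _ h), zero_mul]]
  have hcφ := continuous_gradient_apply hφ i
  have hcψ := continuous_gradient_apply hψ.1 i
  have hsψ := hasCompactSupport_gradient_apply hψ.2.1 i
  simp only [gradient_apply_eq_fderiv] at hcφ hcψ hsψ ⊢
  refine integral_mul_fderiv_eq_neg_fderiv_mul_of_integrable ?_ ?_ ?_
    (fun x _ => hψ.1.differentiable (by simp) x) fun x _ => hφ.differentiable (by simp) x
  · exact (hcψ.mul hφ.continuous).integrable_of_hasCompactSupport hsψ.mul_right
  · exact (hψ.1.continuous.mul hcφ).integrable_of_hasCompactSupport hψ.2.1.mul_right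
  · exact (hψ.1.continuous.mul hφ.continuous).integrable_of_hasCompactSupport hψ.2.1.mul_right

/-- Extension by zero maps `H¹₀(Ω)` into `Ḣ¹(ℝⁿ)`. -/
theorem MemH10.memHomH1_indicator {Ω : Set (EuclideanSpace ℝ (Fin n))} (hΩ : IsOpen Ω)
    (hb : Bornology.IsBounded Ω) {f : EuclideanSpace ℝ (Fin n) → ℝ}
    {g : EuclideanSpace ℝ (Fin n) → EuclideanSpace ℝ (Fin n)} (h : MemH10 Ω f g) :
    MemHomH1 (Ω.indicator f) (Ω.indicator g) := by
  obtain ⟨⟨-, hf, hg⟩, ψ, hψ, hlim, hlim'⟩ := h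
  have hΩm := hΩ.measurableSet
  have : IsFiniteMeasure (volume.restrict Ω) :=
    ⟨by rw [Measure.restrict_apply_univ]; exact hb.measure_lt_top⟩
  have hf' : MemLp (Ω.indicator f) 2 volume := (memLp_indicator_iff_restrict hΩm).2 hf
  have hg' : MemLp (Ω.indicator g) 2 volume := (memLp_indicator_iff_restrict hΩm).2 hg
  refine ⟨⟨locallyIntegrableOn_univ.2 (hf'.locallyIntegrable (by norm_num)),
    locallyIntegrableOn_univ.2 (hg'.locallyIntegrable (by norm_num)), fun φ hφ i => ?_⟩, hg'⟩
  have e1 : ∫ x, Ω.indicator f x * (gradient φ x) i = ∫ x in Ω, f x * (gradient φ x) i := by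
    rw [← integral_indicator hΩm]
    refine integral_congr_ae (Eventually.of_forall fun x => ?_)
    by_cases hx : x ∈ Ω <;> simp [hx]
  have e2 : ∫ x, (Ω.indicator g x) i * φ x = ∫ x in Ω, (g x) i * φ x := by
    rw [← integral_indicator hΩm]
    refine integral_congr_ae (Eventually.of_forall fun x => ?_)
    by_cases hx : x ∈ Ω <;> simp [hx]
  rw [Measure.restrict_univ, e1, e2]
  have hcont := continuous_gradient_apply hφ.1 i
  obtain ⟨M₁, hM₁⟩ := (hasCompactSupport_gradient_apply hφ.2.1 i).exists_bound_of_continuous hcont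
  obtain ⟨M₂, hM₂⟩ := hφ.2.1.exists_bound_of_continuous hφ.1.continuous
  have hgi : MemLp (fun x => (g x) i) 2 (volume.restrict Ω) :=
    (EuclideanSpace.proj (𝕜 := ℝ) i).comp_memLp' hg
  have hψi : ∀ k, MemLp (fun x => (gradient (ψ k) x) i) 2 (volume.restrict Ω) := fun k =>
    ((continuous_gradient_apply (hψ k).1 i).memLp_of_hasCompactSupport
      (hasCompactSupport_gradient_apply (hψ k).2.1 i)).restrict Ω
  -- `φ` need not be supported in `Ω`, so it is not admissible for the weak gradient of `f` there.
  -- The approximants `ψ k` are supported in `Ω`, so parts can be integrated for them without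
  -- boundary terms.
  have t1 := tendsto_integral_mul_of_tendsto_eLpNorm_two (fun k =>
    (((hψ k).1.continuous.memLp_of_hasCompactSupport (hψ k).2.1).restrict Ω)) hf
    hcont.aestronglyMeasurable hM₁ hlim
  have t2 := tendsto_integral_mul_of_tendsto_eLpNorm_two hψi hgi
    hφ.1.continuous.aestronglyMeasurable hM₂ (by
      refine tendsto_of_tendsto_of_tendsto_of_le_of_le tendsto_const_nhds hlim'
        (fun _ => zero_le) fun k => eLpNorm_mono fun x => ?_
      exact PiLp.norm_apply_le (gradient (ψ k) x - g x) i)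
  refine tendsto_nhds_unique t1 (t2.neg.congr fun k => ?_)
  exact ((hψ k).setIntegral_mul_gradient hφ.1 i).symm

end Extension

/-- Weak Ladyzhenskaya inequality on the plane. -/
theorem weak_ladyzhenskaya_plane :
    ∃ c : ℝ≥0, ∀ (f : EuclideanSpace ℝ (Fin 2) → ℝ)
      (g : EuclideanSpace ℝ (Fin 2) → EuclideanSpace ℝ (Fin 2)),
      MemWeakLp f 2 volume → MemHomH1 f g →
      MemLp f 4 volume ∧
      eLpNorm f 4 volume ≤
        c * weakLpNorm f 2 volume ^ (1 / 2 : ℝ) * eLpNorm g 2 volume ^ (1 / 2 : ℝ) := by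
  obtain ⟨c, hc⟩ := eLpNorm_le_weakLpNorm_mul_bmoSeminorm 2 (by norm_num) (q := 2) (p := 4)
    (by norm_num) (by norm_num)
  refine ⟨c * 8 ^ (1 / 2 : ℝ), fun f g hw h => ?_⟩
  obtain ⟨hmem, hle⟩ := hc f hw h.memBMO.1
  rw [show ENNReal.ofReal 4 = 4 by simp] at hmem hle
  refine ⟨hmem, hle.trans ?_⟩
  have h8 : ((8 ^ (1 / 2 : ℝ) : ℝ≥0) : ℝ≥0∞) = 8 ^ (1 / 2 : ℝ) := by
    rw [ENNReal.coe_rpow_of_nonneg _ (by norm_num)]; simp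
  rw [show (2 / 4 : ℝ) = 1 / 2 by norm_num, show (1 - 1 / 2 : ℝ) = 1 / 2 by norm_num,
    ENNReal.coe_mul, h8]
  calc c * weakLpNorm f 2 volume ^ (1 / 2 : ℝ) * bmoSeminorm f ^ (1 / 2 : ℝ)
      ≤ c * weakLpNorm f 2 volume ^ (1 / 2 : ℝ) * (8 * eLpNorm g 2 volume) ^ (1 / 2 : ℝ) := by
        gcongr; exact h.memBMO.2
    _ = _ := by
        rw [ENNReal.mul_rpow_of_nonneg _ _ (by norm_num)]; ring

/-- Weak Ladyzhenskaya inequality for mean-zero functions on the unit square. -/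
theorem weak_ladyzhenskaya_unit_square :
    ∃ c : ℝ≥0, ∀ (f : EuclideanSpace ℝ (Fin 2) → ℝ)
      (g : EuclideanSpace ℝ (Fin 2) → EuclideanSpace ℝ (Fin 2)),
      IsWeakGradient Set.univ f g → MemLp f 2 (volume.restrict (axisCube 0 1)) →
      MemLp g 2 (volume.restrict (axisCube 0 1)) →
      (∫ x in axisCube 0 1, f x) = 0 →
      MemLp f 4 (volume.restrict (axisCube 0 1)) ∧
      eLpNorm f 4 (volume.restrict (axisCube 0 1)) ≤
        c * weakLpNorm f 2 (volume.restrict (axisCube 0 1)) ^ (1 / 2 : ℝ) *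
          eLpNorm g 2 (volume.restrict (axisCube 0 1)) ^ (1 / 2 : ℝ) := by
  obtain ⟨K, hK⟩ := lintegral_rpow_axisCube_le 2 (q := 2) (p := 4) (by norm_num) (by norm_num)
  refine ⟨K ^ (1 / 4 : ℝ) * 8 ^ (1 / 2 : ℝ), fun f g h hf hg h0 => ?_⟩
  have hw := MemLp.weakLpNorm_two_lt_top hf
  have hfl := locallyIntegrableOn_univ.1 h.1
  -- Oscillation is needed only on subsquares of the unit square, where the local Poincaré bound
  -- sees the gradient on that square alone; the zero mean supplies the smallness of the average.
  have key := eLpNorm_le_of_forall_bounds (μ := volume.restrict (axisCube 0 1)) (f := f) (q := 2)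
    (p := 4) (by norm_num) (by norm_num) (K := K)
    (b := 8 * eLpNorm g 2 (volume.restrict (axisCube 0 1)))
    (ENNReal.mul_lt_top (by simp) hg.2) hw fun B C hB hC hb hweak => by
      refine hK f 0 1 B C one_pos hB hC (hfl.integrableOn_isCompact (isCompact_axisCube _ _))
        (fun a' s' hs' hsub => ?_) ?_ hweak
      · refine (h.laverage_oscillation_le a' hs').trans (le_trans ?_ hb)
        gcongr
      · rw [setAverage_eq, h0]; simp [hB.le]
  rw [show ENNReal.ofReal 4 = 4 by simp, show (2 / 4 : ℝ) = 1 / 2 by norm_num,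
    show (1 - 1 / 2 : ℝ) = 1 / 2 by norm_num, ENNReal.mul_rpow_of_nonneg _ _ (by norm_num)] at key
  have h8 : ((8 ^ (1 / 2 : ℝ) : ℝ≥0) : ℝ≥0∞) = 8 ^ (1 / 2 : ℝ) := by
    rw [ENNReal.coe_rpow_of_nonneg _ (by norm_num)]; simp
  have hle : eLpNorm f 4 (volume.restrict (axisCube 0 1)) ≤
      (K ^ (1 / 4 : ℝ) * 8 ^ (1 / 2 : ℝ) : ℝ≥0) *
        weakLpNorm f 2 (volume.restrict (axisCube 0 1)) ^ (1 / 2 : ℝ) *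
          eLpNorm g 2 (volume.restrict (axisCube 0 1)) ^ (1 / 2 : ℝ) := by
    refine key.trans (le_of_eq ?_)
    rw [ENNReal.coe_mul, h8]
    ring
  refine ⟨⟨hf.1, hle.trans_lt ?_⟩, hle⟩
  exact ENNReal.mul_lt_top (ENNReal.mul_lt_top ENNReal.coe_lt_top
    (ENNReal.rpow_lt_top_of_nonneg (by norm_num) hw.ne))
    (ENNReal.rpow_lt_top_of_nonneg (by norm_num) hg.2.ne)

theorem mainTheorem2 :
    -- interpolation between weak Lebesgue spaces and `BMO` on `ℝⁿ`
    (∀ (n : ℕ) (q p : ℝ), 1 ≤ n → 1 ≤ q → q < p →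
      ∃ c : ℝ≥0, ∀ f : EuclideanSpace ℝ (Fin n) → ℝ, MemWeakLp f q volume → MemBMO f →
        MemLp f (ENNReal.ofReal p) volume ∧
        eLpNorm f (ENNReal.ofReal p) volume ≤
          c * weakLpNorm f q volume ^ (q / p) * bmoSeminorm f ^ (1 - q / p)) ∧
    -- `Ḣ¹(ℝ²) ⊂ BMO(ℝ²)`
    (∃ c : ℝ≥0, ∀ (f : EuclideanSpace ℝ (Fin 2) → ℝ)
        (g : EuclideanSpace ℝ (Fin 2) → EuclideanSpace ℝ (Fin 2)), MemHomH1 f g →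
        MemBMO f ∧ bmoSeminorm f ≤ c * eLpNorm g 2 volume) ∧
    -- weak Ladyzhenskaya inequality on `ℝ²`
    (∃ c : ℝ≥0, ∀ (f : EuclideanSpace ℝ (Fin 2) → ℝ)
        (g : EuclideanSpace ℝ (Fin 2) → EuclideanSpace ℝ (Fin 2)),
        MemWeakLp f 2 volume → MemHomH1 f g →
        MemLp f 4 volume ∧
        eLpNorm f 4 volume ≤
          c * weakLpNorm f 2 volume ^ (1 / 2 : ℝ) * eLpNorm g 2 volume ^ (1 / 2 : ℝ)) ∧
    -- weak Ladyzhenskaya inequality on bounded open subsets of the plane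
    (∃ c : ℝ≥0, ∀ Ω : Set (EuclideanSpace ℝ (Fin 2)), IsOpen Ω → Bornology.IsBounded Ω →
        ∀ (f : EuclideanSpace ℝ (Fin 2) → ℝ)
          (g : EuclideanSpace ℝ (Fin 2) → EuclideanSpace ℝ (Fin 2)), MemH10 Ω f g →
        MemLp f 4 (volume.restrict Ω) ∧
        eLpNorm f 4 (volume.restrict Ω) ≤
          c * weakLpNorm f 2 (volume.restrict Ω) ^ (1 / 2 : ℝ) *
            eLpNorm g 2 (volume.restrict Ω) ^ (1 / 2 : ℝ)) ∧
    -- weak Ladyzhenskaya inequality on `[0,1]²` with periodic boundary conditions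
    (∃ c : ℝ≥0, ∀ (f : EuclideanSpace ℝ (Fin 2) → ℝ)
        (g : EuclideanSpace ℝ (Fin 2) → EuclideanSpace ℝ (Fin 2)), MemH1Per f g →
        (∫ x in axisCube 0 1, f x) = 0 →
        MemLp f 4 (volume.restrict (axisCube 0 1)) ∧
        eLpNorm f 4 (volume.restrict (axisCube 0 1)) ≤
          c * weakLpNorm f 2 (volume.restrict (axisCube 0 1)) ^ (1 / 2 : ℝ) *
            eLpNorm g 2 (volume.restrict (axisCube 0 1)) ^ (1 / 2 : ℝ)) := by
  obtain ⟨c, hc⟩ := weak_ladyzhenskaya_plane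
  obtain ⟨c', hc'⟩ := weak_ladyzhenskaya_unit_square
  refine ⟨fun n q p hn hq hqp =>
      eLpNorm_le_weakLpNorm_mul_bmoSeminorm n hn (zero_lt_one.trans_le hq) hqp,
    ⟨8, fun f g h => by simpa using h.memBMO⟩, ⟨c, hc⟩, ⟨c, fun Ω hΩ hb f g h => ?_⟩,
    ⟨c', fun f g h h0 => hc' f g h.2.1 h.2.2.1 h.2.2.2 h0⟩⟩
  -- The zero extension has the same norms as `f` on `Ω`, so the constant of the plane serves every
  -- bounded open set.
  have hΩm := hΩ.measurableSet
  have hf : MemLp (Ω.indicator f) 2 volume := (memLp_indicator_iff_restrict hΩm).2 h.1.2.1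
  have key := hc _ _ ⟨hf.1, MemLp.weakLpNorm_two_lt_top hf⟩ (h.memHomH1_indicator hΩ hb)
  rwa [memLp_indicator_iff_restrict hΩm, eLpNorm_indicator_eq_eLpNorm_restrict hΩm,
    eLpNorm_indicator_eq_eLpNorm_restrict hΩm, weakLpNorm_indicator hΩm] at key
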